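/- Let $\mathfrak g$ be a finite-dimensional complex simple Lie algebra with Cartan subalgebra $\mathfrak h$, simple roots $\{\alpha_i\}_{i\in I_0}$, simple coroots $h_i$, fundamental weights $\omega_i$ (so $\omega_i(h_j)=\delta_{ij}$), and $\mathfrak n^+$ the sum of the positive root spaces. For a commutative associative unital $\mathbb C$-algebra $A$, $\mathfrak g\otimes A$ is the Lie algebra with bracket $[x\otimes a,y\otimes b]=[x,y]\otimes ab$. For a dominant integral weight $\lambda$, the global Weyl module $W_A(\lambda)$ is the left $U(\mathfrak g\otimes A)$-module generated by $w_\lambda$ with defining relations $$(\mathfrak n^+\otimes A)w_\lambda=0,\qquad (h\otimes 1)w_\lambda=\lambda(h)w_\lambda\ (h\in\mathfrak h),\qquad (x^-_{\alpha_i}\otimes 1)^{\lambda(h_i)+1}w_\lambda=0\ (i\in I_0),$$ where $x^-_{\alpha_i}$ spans the root space $\mathfrak g_{-\alpha_i}$. For $\lambda=\omega_i$, $W_A(\omega_i)$ is a $(\mathfrak g\otimes A,A)$-bimodule with right action $(u\,w_{\omega_i})a=u(h_i\otimes a)w_{\omega_i}$ ($u\in U(\mathfrak g\otimes A)$, $a\in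 A$). For an ideal $J$ of $A$ put $\mathbf W^{\omega_i}_A(A/J)=W_A(\omega_i)\otimes_A A/J$ and $w_{\omega_i,A/J}=w_{\omega_i}\otimes 1$; for $J$ maximal this is a fundamental local Weyl module. If $\Delta\colon A\to A\otimes A$ is a comultiplication making $A$ a bialgebra and $V$ is a $\mathfrak g\otimes A$-module, $(V\otimes A)_\Delta$ is the $(\mathfrak g\otimes A,A)$-bimodule $V\otimes A$ with $$(x\otimes a)(v\otimes c)=\sum_s (x\otimes a'_s)v\otimes a''_sc,\qquad (v\otimes c)a=v\otimes ca,\qquad\text{where }\Delta(a)=\sum_s a'_s\otimes a''_s .$$ Let $k,\ell\ge 0$ be integers and let $A=\mathcal R_{k,\ell}=\mathbb C[t_1^{\pm1},\dots,t_k^{\pm1},u_1,\dots,u_\ell]$, with the bialgebra comultiplication $\Delta_{k,\ell}$ given by $t_s^{\pm1}\mapsto t_s^{\pm1}\otimes t_s^{\pm1}$ and $u_r\mapsto u_r\otimes1+1\otimes u_r$. Let $\mathfrak I$ be the ideal of $A$ generated by $t_1-1,\dots,t_k-1,u_1,\dots,u_\ell$. **Proposition.** For every $i\in I_0$, the assignment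 $w_{\omega_i}\mapsto w_{\omega_i,A/\mathfrak I}\otimes 1$ defines a (unique) isomorphism of $(\mathfrak g\otimes A,A)$-bimodules $$W_A(\omega_i)\;\xrightarrow{\ \cong\ }\;\bigl(\mathbf W^{\omega_i}_A(A/\mathfrak I)\otimes A\bigr)_{\Delta_{k,\ell}} .$$ -/

import Mathlib

open scoped TensorProduct

noncomputable section

namespace WeylModules

attribute [local instance] LieRing.ofAssociativeRing

/-! ### The enveloping algebra of the map algebra

The Lie algebra `𝔤 ⊗ A` is realised as `A ⊗[ℂ] 𝔤` with the bracket
`⁅a ⊗ x, b ⊗ y⁆ = (a * b) ⊗ ⁅x, y⁆`. Its modules are the left modules over `U(𝔤 ⊗ A)`. -/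

section Current

variable (A 𝔤 : Type*) [CommRing A] [Algebra ℂ A] [LieRing 𝔤] [LieAlgebra ℂ 𝔤]

/-- The universal enveloping algebra `U(𝔤 ⊗ A)`. -/
abbrev U : Type _ := UniversalEnvelopingAlgebra ℂ (A ⊗[ℂ] 𝔤)

variable {A 𝔤}

/-- The element `x ⊗ a` of `𝔤 ⊗ A`, seen in `U(𝔤 ⊗ A)`. -/
def el (a : A) (x : 𝔤) : U A 𝔤 := UniversalEnvelopingAlgebra.ι ℂ (a ⊗ₜ[ℂ] x)

lemma el_mul_el (a b : A) (x y : 𝔤) :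
    el a x * el b y = el b y * el a x + el (a * b) ⁅x, y⁆ := by
  have h := (UniversalEnvelopingAlgebra.ι ℂ (L := A ⊗[ℂ] 𝔤)).map_lie (a ⊗ₜ[ℂ] x) (b ⊗ₜ[ℂ] y)
  rw [LieAlgebra.ExtendScalars.bracket_tmul, LieRing.of_associative_ring_bracket] at h
  rw [el, el, el, h]
  abel

lemma el_add_left (a b : A) (x : 𝔤) : el (a + b) x = el a x + el b x := by
  simp only [el, TensorProduct.add_tmul, map_add]

lemma el_add_right (a : A) (x y : 𝔤) : el a (x + y) = el a x + el a y := by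
  simp only [el, TensorProduct.tmul_add, map_add]

lemma el_zero_left (x : 𝔤) : el (0 : A) x = 0 := by
  simp only [el, TensorProduct.zero_tmul, map_zero]

lemma el_zero_right (a : A) : el a (0 : 𝔤) = 0 := by
  simp only [el, TensorProduct.tmul_zero, map_zero]

lemma el_smul_left (c : ℂ) (a : A) (x : 𝔤) : el (c • a) x = c • el a x := by
  simp only [el, ← TensorProduct.smul_tmul', map_smul]

lemma el_smul_right (c : ℂ) (a : A) (x : 𝔤) : el a (c • x) = c • el a x := by
  simp only [el, TensorProduct.tmul_smul, map_smul]

end Current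

/-! ### Two identities in associative rings -/

section RingIdentities

variable {R : Type*} [Ring R]

lemma pow_succ_mul_of_comm {F X Y : R} (h : F * X = X * F + Y) (hY : F * Y = Y * F) (m : ℕ) :
    F ^ (m + 1) * X = X * F ^ (m + 1) + (m + 1 : R) * (Y * F ^ m) := by
  induction m with
  | zero => simp [h]
  | succ m ih =>
    have hYm : F * (Y * F ^ m) = Y * F ^ (m + 1) := by
      rw [← mul_assoc, hY, mul_assoc, pow_succ']
    have hc : F * ((m + 1 : R) * (Y * F ^ m)) = (m + 1 : R) * (Y * F ^ (m + 1)) := by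
      have : Commute ((m : R) + 1) F := (Nat.cast_commute m F).add_left (Commute.one_left F)
      rw [← hYm, this.symm.left_comm]
    rw [pow_succ', mul_assoc, ih, mul_add, hc, ← mul_assoc F X, h, add_mul, mul_assoc X F,
      ← pow_succ' F (m + 1)]
    push_cast
    noncomm_ring

lemma cartan_mul_pow {F K : R} (h : K * F = F * K - 2 * F) (m : ℕ) :
    K * F ^ m = F ^ m * (K - 2 * (m : R)) := by
  induction m with
  | zero => simp
  | succ m ih =>
    have hc : Commute (m : R) F := Nat.cast_commute m F
    rw [pow_succ, ← mul_assoc, ih, mul_assoc, mul_assoc, sub_mul, h, mul_assoc 2, hc.eq]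
    push_cast
    noncomm_ring

lemma raise_mul_pow {E F K : R} (hE : E * F = F * E + K) (h : K * F = F * K - 2 * F) (m : ℕ) :
    E * F ^ (m + 1) = F ^ (m + 1) * E + (m + 1 : R) * (F ^ m * (K - (m : R))) := by
  induction m with
  | zero => simp [hE]
  | succ m ih =>
    have hc : Commute ((m : R) + 1) F := (Nat.cast_commute m F).add_left (Commute.one_left F)
    have h3 : F * ((m + 1 : R) * (F ^ m * (K - (m : R)))) =
        (m + 1 : R) * (F ^ (m + 1) * (K - (m : R))) := by
      rw [← mul_assoc, ← hc.eq, mul_assoc, ← mul_assoc F, pow_succ']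
    have h4 : (F ^ (m + 1)) * (m : R) = (m : R) * F ^ (m + 1) :=
      ((Nat.cast_commute m F).pow_right (m + 1)).eq.symm
    rw [pow_succ' F (m + 1), ← mul_assoc, hE, add_mul, mul_assoc F E, ih, mul_add, h3,
      cartan_mul_pow h, ← mul_assoc F (F ^ (m + 1)) E]
    push_cast
    simp only [mul_sub, mul_add, add_mul, mul_one, one_mul, two_mul, h4]
    noncomm_ring

end RingIdentities

/-! ### Global Weyl modules -/

section Global

variable {𝔤 : Type*} [LieRing 𝔤] [LieAlgebra ℂ 𝔤] [FiniteDimensional ℂ 𝔤]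
  [LieAlgebra.IsSimple ℂ 𝔤] {H : LieSubalgebra ℂ 𝔤} [H.IsCartanSubalgebra]
  (b : (LieAlgebra.IsKilling.rootSystem H).Base)

/-- The simple root `α_i`, as a function on the Cartan subalgebra. -/
def simpleRoot (i : b.support) : H → ℂ := ⇑(i : H.root).1

/-- The simple coroot `h_i`. -/
def simpleCoroot (i : b.support) : H := LieAlgebra.IsKilling.coroot (i : H.root).1

/-- The fundamental weight `ω_i`: the basis of `𝔥*` dual to the basis of simple coroots. -/
def fundamentalWeight (i : b.support) : Module.Dual ℂ H := b.toCoweightBasis.coord i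

/-- The dominant integral weight `λ = ∑ r_i ω_i`, so that `λ(h_i) = r_i`. -/
def weight (r : b.support → ℕ) : Module.Dual ℂ H := ∑ i, r i • fundamentalWeight b i

/-- `𝔫⁺`, the sum of the root spaces of the positive roots. -/
def nPlus : Submodule ℂ 𝔤 :=
  ⨆ α : {α : H.root // b.IsPos α}, (LieAlgebra.rootSpace H (⇑α.1.1)).toSubmodule

variable (A : Type*) [CommRing A] [Algebra ℂ A]

/-- The defining relations of the global Weyl module of highest weight `λ = ∑ r_i ω_i`:
`𝔫⁺ ⊗ A` kills the generator, `h - λ(h)` kills it for `h ∈ 𝔥`, and so does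
`f ^ (λ(h_i) + 1)` for every `i` and every `f` in the (one-dimensional) root space of `-α_i`. -/
def relations (r : b.support → ℕ) : Set (U A 𝔤) :=
  {u | ∃ a : A, ∃ x ∈ nPlus b, u = el a x} ∪
  {u | ∃ h : H, u = el 1 (h : 𝔤) - algebraMap ℂ (U A 𝔤) (weight b r h)} ∪
  {u | ∃ i : b.support, ∃ f ∈ LieAlgebra.rootSpace H (-simpleRoot b i),
    u = el 1 f ^ (r i + 1)}

/-- The global Weyl module `W_A(λ)`, `λ = ∑ r_i ω_i`: the quotient of `U(𝔤 ⊗ A)` by the left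
ideal generated by the defining relations. -/
def GlobalWeyl (r : b.support → ℕ) : Type _ :=
  U A 𝔤 ⧸ (Submodule.span (U A 𝔤) (relations b A r) : Submodule (U A 𝔤) (U A 𝔤))

namespace GlobalWeyl

variable (r : b.support → ℕ)

instance : AddCommGroup (GlobalWeyl b A r) :=
  inferInstanceAs (AddCommGroup (U A 𝔤 ⧸ Submodule.span (U A 𝔤) (relations b A r)))

instance : Module (U A 𝔤) (GlobalWeyl b A r) :=
  inferInstanceAs (Module (U A 𝔤) (U A 𝔤 ⧸ Submodule.span (U A 𝔤) (relations b A r)))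

instance : Module ℂ (GlobalWeyl b A r) :=
  inferInstanceAs (Module ℂ (U A 𝔤 ⧸ Submodule.span (U A 𝔤) (relations b A r)))

instance : IsScalarTower ℂ (U A 𝔤) (GlobalWeyl b A r) :=
  inferInstanceAs
    (IsScalarTower ℂ (U A 𝔤) (U A 𝔤 ⧸ Submodule.span (U A 𝔤) (relations b A r)))

/-- The generator `w_λ`. -/
def gen : GlobalWeyl b A r :=
  Submodule.Quotient.mk (p := Submodule.span (U A 𝔤) (relations b A r)) 1

variable {A r}

lemma smul_gen (u : U A 𝔤) : u • gen b A r =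
    Submodule.Quotient.mk (p := Submodule.span (U A 𝔤) (relations b A r)) u := by
  change Submodule.Quotient.mk (p := Submodule.span (U A 𝔤) (relations b A r)) (u • 1) = _
  rw [smul_eq_mul, mul_one]

lemma smul_gen_eq_zero {u : U A 𝔤} (hu : u ∈ relations b A r) : u • gen b A r = 0 := by
  rw [smul_gen]
  exact (Submodule.Quotient.mk_eq_zero _).2 (Submodule.subset_span hu)

lemma exists_smul_gen (w : GlobalWeyl b A r) : ∃ u : U A 𝔤, w = u • gen b A r := by
  obtain ⟨u, rfl⟩ := Submodule.Quotient.mk_surjective _ w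
  exact ⟨u, (smul_gen b u).symm⟩

variable (r) in
/-- The map `u w_λ ↦ u v`, for a vector `v` that satisfies the defining relations. -/
def desc {V : Type*} [AddCommGroup V] [Module (U A 𝔤) V] (v : V)
    (hv : ∀ u ∈ relations b A r, u • v = 0) : GlobalWeyl b A r →ₗ[U A 𝔤] V :=
  Submodule.liftQ (Submodule.span (U A 𝔤) (relations b A r))
    (LinearMap.toSpanSingleton (U A 𝔤) V v)
    (Submodule.span_le.2 fun u hu => by simpa using hv u hu)

lemma desc_gen {V : Type*} [AddCommGroup V] [Module (U A 𝔤) V] (v : V)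
    (hv : ∀ u ∈ relations b A r, u • v = 0) : desc b r v hv (gen b A r) = v := by
  change LinearMap.toSpanSingleton (U A 𝔤) V v 1 = v
  simp

lemma hom_ext {V : Type*} [AddCommGroup V] [Module (U A 𝔤) V]
    {φ ψ : GlobalWeyl b A r →ₗ[U A 𝔤] V} (h : φ (gen b A r) = ψ (gen b A r)) : φ = ψ := by
  ext w
  obtain ⟨u, rfl⟩ := exists_smul_gen b w
  rw [map_smul, map_smul, h]

end GlobalWeyl

end Global

/-! ### The right action on global Weyl modules -/

section RightAction

variable {𝔤 : Type*} [LieRing 𝔤] [LieAlgebra ℂ 𝔤] [FiniteDimensional ℂ 𝔤]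
  [LieAlgebra.IsSimple ℂ 𝔤] {H : LieSubalgebra ℂ 𝔤} [H.IsCartanSubalgebra]
  (b : (LieAlgebra.IsKilling.rootSystem H).Base)

lemma weight_coroot (r : b.support → ℕ) (i : b.support) :
    weight b r (simpleCoroot b i) = r i := by
  have h (j : b.support) :
      fundamentalWeight b j (simpleCoroot b i) = (Finsupp.single i (1 : ℂ)) j := by
    rw [fundamentalWeight, Module.Basis.coord_apply, ← b.toCoweightBasis_repr_coroot i]
    rfl
  rw [weight, LinearMap.sum_apply, Finset.sum_eq_single i]
  · simp [h]
  · intro j _ hj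
    simp [h, hj]
  · simp

lemma lie_mem_nPlus (h : H) {x : 𝔤} (hx : x ∈ nPlus b) : ⁅x, (h : 𝔤)⁆ ∈ nPlus b := by
  rw [← lie_skew, neg_mem_iff]
  rw [nPlus] at hx
  induction hx using Submodule.iSup_induction' with
  | mem α x hx =>
    have : ⁅(h : 𝔤), x⁆ = α.1.1 h • x := LieAlgebra.IsKilling.lie_eq_smul_of_mem_rootSpace hx h
    rw [this]
    exact Submodule.smul_mem _ _ (Submodule.mem_iSup_of_mem α hx)
  | zero => simp
  | add x y _ _ hx hy => rw [lie_add]; exact add_mem hx hy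

lemma exists_sl2 (i : b.support) : ∃ e f : 𝔤, e ∈ nPlus b ∧
    f ∈ LieAlgebra.rootSpace H (-simpleRoot b i) ∧
    ⁅e, f⁆ = (simpleCoroot b i : 𝔤) ∧ ⁅(simpleCoroot b i : 𝔤), f⁆ = -(2 : ℂ) • f ∧
    ∀ f' ∈ LieAlgebra.rootSpace H (-simpleRoot b i), ∃ c : ℂ, f' = c • f := by
  have hα : (i : H.root).1.IsNonZero := by
    obtain ⟨⟨α, hα⟩, _⟩ := i
    simpa using hα
  obtain ⟨h, e, f, t, he, hf⟩ :=
    LieAlgebra.IsKilling.exists_isSl2Triple_of_weight_isNonZero hα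
  have hh := t.h_eq_coroot hα he hf
  refine ⟨e, f, ?_, hf, ?_, ?_, ?_⟩
  · exact Submodule.mem_iSup_of_mem
      (p := fun α : {α : H.root // b.IsPos α} =>
        (LieAlgebra.rootSpace H (⇑α.1.1)).toSubmodule)
      ⟨i, b.isPos_of_mem_support i.2⟩ he
  · rw [t.lie_e_f, hh]; rfl
  · have := t.lie_lie_smul_f ℂ
    rw [hh] at this
    rw [neg_smul]
    exact this
  · intro f' hf'
    obtain ⟨c, hc⟩ := (finrank_eq_one_iff_of_nonzero' (⟨f, hf⟩ :
        LieAlgebra.rootSpace H (-⇑(i : H.root).1)) (by simpa using t.f_ne_zero)).mp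
      (LieAlgebra.IsKilling.finrank_rootSpace_eq_one (-(i : H.root).1) (by simpa)) ⟨f', hf'⟩
    exact ⟨c, by simpa using (congrArg Subtype.val hc).symm⟩

namespace GlobalWeyl

variable {A : Type*} [CommRing A] [Algebra ℂ A] {r : b.support → ℕ}

lemma nPlus_smul_gen (a : A) {x : 𝔤} (hx : x ∈ nPlus b) : el a x • gen b A r = 0 :=
  smul_gen_eq_zero b (Or.inl (Or.inl ⟨a, x, hx, rfl⟩))

lemma cartan_smul_gen (h : H) :
    el (1 : A) (h : 𝔤) • gen b A r = weight b r h • gen b A r := by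
  have := smul_gen_eq_zero b (A := A) (r := r) (Or.inl (Or.inr ⟨h, rfl⟩))
  rw [sub_smul, sub_eq_zero, algebraMap_smul] at this
  exact this

lemma pow_smul_gen (i : b.support) {f : 𝔤}
    (hf : f ∈ LieAlgebra.rootSpace H (-simpleRoot b i)) :
    el (1 : A) f ^ (r i + 1) • gen b A r = 0 :=
  smul_gen_eq_zero b (Or.inr ⟨i, f, hf, rfl⟩)

lemma nPlus_smul_cartan_smul_gen (a c : A) {x : 𝔤} (hx : x ∈ nPlus b) (h : H) :
    el a x • el c (h : 𝔤) • gen b A r = 0 := by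
  rw [smul_smul, el_mul_el, add_smul, mul_smul, nPlus_smul_gen b a hx,
    nPlus_smul_gen b _ (lie_mem_nPlus b h hx), smul_zero, add_zero]

lemma cartan_comm (a c : A) (h h' : H) :
    el a (h : 𝔤) * el c (h' : 𝔤) = el c (h' : 𝔤) * el a (h : 𝔤) := by
  have : ⁅(h : 𝔤), (h' : 𝔤)⁆ = 0 := by
    rw [← LieSubalgebra.coe_bracket, trivial_lie_zero]; rfl
  rw [el_mul_el, this, el_zero_right, add_zero]

/-- The vectors `(h ⊗ a) w_λ` satisfy the defining relations of `W_A(λ)`. -/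
lemma relations_cartan_smul_gen (a : A) (h : H) (u : U A 𝔤) (hu : u ∈ relations b A r) :
    u • el a (h : 𝔤) • gen b A r = 0 := by
  rcases hu with (⟨c, x, hx, rfl⟩ | ⟨h', rfl⟩) | ⟨i, f', hf', rfl⟩
  · exact nPlus_smul_cartan_smul_gen b c a hx h
  · rw [sub_smul, smul_smul, cartan_comm, mul_smul, cartan_smul_gen, algebraMap_smul,
      smul_comm, sub_self]
  · obtain ⟨e, f, he, hf, hef, hhf, huniq⟩ := exists_sl2 b i
    obtain ⟨c, rfl⟩ := huniq f' hf'
    rw [el_smul_right, smul_pow, smul_assoc]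
    suffices key : el (1 : A) f ^ (r i + 1) • el a (h : 𝔤) • gen b A r = 0 by
      rw [key, smul_zero]
    set F : U A 𝔤 := el (1 : A) f with hF
    set E : U A 𝔤 := el (1 : A) e with hE
    set K : U A 𝔤 := el (1 : A) (simpleCoroot b i : 𝔤) with hK
    set X : U A 𝔤 := el a (h : 𝔤) with hX
    set w := gen b A r with hw
    have hEF : E * F = F * E + K := by
      rw [hE, hF, el_mul_el, hef, mul_one]
    have hKF : K * F = F * K - 2 * F := by
      rw [hK, hF, el_mul_el, hhf, mul_one, el_smul_right, neg_smul, ← sub_eq_add_neg,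
        ofNat_smul_eq_nsmul ℂ 2, nsmul_eq_mul]
      norm_num
    have hhf' : ⁅f, (h : 𝔤)⁆ = simpleRoot b i h • f := by
      have : ⁅(h : 𝔤), f⁆ = (-simpleRoot b i) h • f :=
        LieAlgebra.IsKilling.lie_eq_smul_of_mem_rootSpace hf h
      rw [← lie_skew, this, Pi.neg_apply, neg_smul, neg_neg]
    have hFX : F * X = X * F + el a (simpleRoot b i h • f) := by
      rw [hF, hX, el_mul_el, hhf', one_mul]
    have hFY : F * el a (simpleRoot b i h • f) = el a (simpleRoot b i h • f) * F := by
      rw [hF, el_mul_el, lie_smul, lie_self, smul_zero, el_zero_right, add_zero]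
    have hFw : F ^ (r i + 1) • w = 0 := pow_smul_gen b i hf
    have hFw' : F ^ (r i + 1 + 1) • w = 0 := by rw [pow_succ', mul_smul, hFw, smul_zero]
    have hEv : E • X • w = 0 := nPlus_smul_cartan_smul_gen b 1 a he h
    have hKv : K • X • w = (r i : ℂ) • X • w := by
      rw [smul_smul, hK, hX, cartan_comm, mul_smul, cartan_smul_gen, weight_coroot, smul_comm]
    have hnat (n : ℕ) (v : GlobalWeyl b A r) : (n : U A 𝔤) • v = (n : ℂ) • v := by
      rw [Nat.cast_smul_eq_nsmul, Nat.cast_smul_eq_nsmul]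
    have hFy : F • F ^ (r i + 1) • X • w = 0 := by
      rw [smul_smul, ← pow_succ', smul_smul, pow_succ_mul_of_comm hFX hFY, add_smul, mul_smul,
        mul_smul, mul_smul, hFw, hFw', smul_zero, smul_zero, smul_zero, add_zero]
    have hEy : E • F ^ (r i + 1) • X • w = 0 := by
      rw [smul_smul, raise_mul_pow hEF hKF, add_smul, mul_smul, hEv, smul_zero, zero_add,
        mul_smul, mul_smul, sub_smul, hKv, hnat, sub_self, smul_zero, smul_zero]
    have hKy : K • F ^ (r i + 1) • X • w = 
        (-(r i : ℂ) - 2) • F ^ (r i + 1) • X • w := by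
      have h2 : (2 : U A 𝔤) * ((r i + 1 : ℕ) : U A 𝔤) = ((2 * (r i + 1) : ℕ) : U A 𝔤) := by
        push_cast; rfl
      rw [smul_smul, cartan_mul_pow hKF, h2, mul_smul, sub_smul, hKv, hnat, ← sub_smul,
        smul_comm]
      congr 1
      push_cast
      ring
    have h0 : (-(r i : ℂ) - 2) • F ^ (r i + 1) • X • w = 0 := by
      rw [← hKy]
      have h1 : E • F • F ^ (r i + 1) • X • w = (F * E + K) • F ^ (r i + 1) • X • w := by
        rw [smul_smul, hEF]
      rw [hFy, smul_zero, add_smul, mul_smul, hEy, smul_zero, zero_add] at h1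
      exact h1.symm
    refine (smul_eq_zero.1 h0).resolve_left fun h3 => ?_
    have h4 : ((r i + 2 : ℕ) : ℂ) = 0 := by
      push_cast
      linear_combination -h3
    exact absurd (Nat.cast_eq_zero.1 h4) (by omega)

/-- The right action of `h ⊗ a`, `h ∈ 𝔥`, on `W_A(λ)`: `(u w_λ)(h ⊗ a) = u (h ⊗ a) w_λ`. -/
def rightMul (a : A) (h : H) : GlobalWeyl b A r →ₗ[U A 𝔤] GlobalWeyl b A r :=
  desc b r (el a (h : 𝔤) • gen b A r) (relations_cartan_smul_gen b a h)

lemma rightMul_smul_gen (a : A) (h : H) (u : U A 𝔤) :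
    rightMul b a h (u • gen b A r) = u • el a (h : 𝔤) • gen b A r := by
  rw [map_smul, rightMul, desc_gen]

lemma rightMul_gen (a : A) (h : H) :
    rightMul b a h (gen b A r) = el a (h : 𝔤) • gen b A r := desc_gen ..

end GlobalWeyl

end RightAction

/-! ### Fundamental global and local Weyl modules -/

section Fundamental

variable {𝔤 : Type*} [LieRing 𝔤] [LieAlgebra ℂ 𝔤] [FiniteDimensional ℂ 𝔤]
  [LieAlgebra.IsSimple ℂ 𝔤] {H : LieSubalgebra ℂ 𝔤} [H.IsCartanSubalgebra]
  (b : (LieAlgebra.IsKilling.rootSystem H).Base)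
  (A : Type*) [CommRing A] [Algebra ℂ A]

open Classical in
/-- The coefficients of `ω_i` in terms of the fundamental weights. -/
def fundCoeff (i : b.support) : b.support → ℕ := fun j => if j = i then 1 else 0

lemma fundCoeff_self (i : b.support) : fundCoeff b i i = 1 := if_pos rfl

lemma weight_fundCoeff (i : b.support) : weight b (fundCoeff b i) = fundamentalWeight b i := by
  rw [weight, Finset.sum_eq_single i]
  · rw [fundCoeff_self, one_smul]
  · intro j _ hj
    rw [fundCoeff, if_neg hj, zero_smul]
  · simp

/-- The fundamental global Weyl module `W_A(ω_i)`. -/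
def FundGlobalWeyl (i : b.support) : Type _ := GlobalWeyl b A (fundCoeff b i)

namespace FundGlobalWeyl

variable (i : b.support)

instance : AddCommGroup (FundGlobalWeyl b A i) :=
  inferInstanceAs (AddCommGroup (GlobalWeyl b A _))

instance : Module (U A 𝔤) (FundGlobalWeyl b A i) :=
  inferInstanceAs (Module (U A 𝔤) (GlobalWeyl b A _))

instance : Module ℂ (FundGlobalWeyl b A i) :=
  inferInstanceAs (Module ℂ (GlobalWeyl b A _))

instance : IsScalarTower ℂ (U A 𝔤) (FundGlobalWeyl b A i) :=
  inferInstanceAs (IsScalarTower ℂ (U A 𝔤) (GlobalWeyl b A _))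

/-- The generator `w_{ω_i}`. -/
def gen : FundGlobalWeyl b A i := GlobalWeyl.gen b A _

variable {A}

lemma cartan_mul_smul_gen (a c : A) :
    el a (simpleCoroot b i : 𝔤) • el c (simpleCoroot b i : 𝔤) • gen b A i =
      el (a * c) (simpleCoroot b i : 𝔤) • gen b A i := by
  obtain ⟨e, f, he, hf, hef, hhf, -⟩ := exists_sl2 b i
  set w := gen b A i with hw
  have hff : el (1 : A) f • el (1 : A) f • w = 0 := by
    have := GlobalWeyl.pow_smul_gen b (A := A) (r := fundCoeff b i) i hf
    rw [fundCoeff_self, pow_two, mul_smul] at this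
    exact this
  have hE (a : A) : el a e • w = 0 := GlobalWeyl.nPlus_smul_gen b a he
  have hEK (a c : A) : el a e • el c (simpleCoroot b i : 𝔤) • w = 0 :=
    GlobalWeyl.nPlus_smul_cartan_smul_gen b a c he _
  have hEF (a c : A) (v : FundGlobalWeyl b A i) : el a e • el c f • v =
      el c f • el a e • v + el (a * c) (simpleCoroot b i : 𝔤) • v := by
    rw [smul_smul, el_mul_el, hef, add_smul, mul_smul]
  have hKF (a c : A) (v : FundGlobalWeyl b A i) : el a (simpleCoroot b i : 𝔤) • el c f • v =
      el c f • el a (simpleCoroot b i : 𝔤) • v - (2 : ℂ) • el (a * c) f • v := by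
    rw [smul_smul, el_mul_el, hhf, add_smul, mul_smul, el_smul_right, smul_assoc, neg_smul,
      sub_eq_add_neg]
  have h1 : el (1 : A) f • el c (simpleCoroot b i : 𝔤) • w = el c f • w := by
    have h := hEF c 1 (el (1 : A) f • w)
    rw [hff, smul_zero, hEF, hE, smul_zero, zero_add, mul_one, hKF, mul_one] at h
    have h2 : (2 : ℂ) • (el (1 : A) f • el c (simpleCoroot b i : 𝔤) • w - el c f • w) = 0 := by
      rw [smul_sub, two_smul ℂ (el (1 : A) f • el c (simpleCoroot b i : 𝔤) • w), h]
      abel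
    exact sub_eq_zero.1 ((smul_eq_zero.1 h2).resolve_left two_ne_zero)
  have h2 := congrArg (fun v => el a e • v) h1
  simp only [hEF, hEK, hE, smul_zero, zero_add, mul_one] at h2
  exact h2

lemma coroot_smul_gen : el (1 : A) (simpleCoroot b i : 𝔤) • gen b A i = gen b A i := by
  have h := GlobalWeyl.cartan_smul_gen b (A := A) (r := fundCoeff b i)
    (simpleCoroot b i)
  rw [weight_coroot, fundCoeff_self, Nat.cast_one, one_smul] at h
  exact h

variable (A)

variable {A} in
lemma hom_ext {V : Type*} [AddCommGroup V] [Module (U A 𝔤) V]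
    {φ ψ : FundGlobalWeyl b A i →ₗ[U A 𝔤] V} (h : φ (gen b A i) = ψ (gen b A i)) : φ = ψ :=
  GlobalWeyl.hom_ext b h

variable {A} in
/-- The right action of `h_i ⊗ a` on `W_A(ω_i)`: `u w_{ω_i} ↦ u (h_i ⊗ a) w_{ω_i}`. -/
def act (a : A) : Module.End (U A 𝔤) (FundGlobalWeyl b A i) :=
  GlobalWeyl.rightMul b a (simpleCoroot b i)

variable {A} in
lemma act_gen (a : A) :
    act b i a (gen b A i) = el a (simpleCoroot b i : 𝔤) • gen b A i :=
  GlobalWeyl.rightMul_gen b a (simpleCoroot b i)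

/-- The right action of `A` on `W_A(ω_i)`, where `a` acts as `h_i ⊗ a`. -/
def rightAction : A →ₐ[ℂ] Module.End (U A 𝔤) (FundGlobalWeyl b A i) :=
  AlgHom.ofLinearMap
    { toFun := act b i
      map_add' := fun a c => hom_ext b i (by
        rw [LinearMap.add_apply, act_gen, act_gen, act_gen, el_add_left, add_smul])
      map_smul' := fun z a => hom_ext b i (by
        rw [RingHom.id_apply, LinearMap.smul_apply, act_gen, act_gen, el_smul_left,
          smul_assoc]) }
    (hom_ext b i (by
      change act b i 1 (gen b A i) = gen b A i
      rw [act_gen, coroot_smul_gen]))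
    (fun a c => hom_ext b i (by
      change act b i (a * c) (gen b A i) = act b i a (act b i c (gen b A i))
      rw [act_gen, act_gen, map_smul, act_gen, mul_comm a c, cartan_mul_smul_gen]))

/-- `W_A(ω_i)` as an `A`-module (`A` is commutative, so right modules are left modules). -/
instance : Module A (FundGlobalWeyl b A i) :=
  Module.compHom _ (rightAction b A i).toRingHom

variable {A}

/-- The formula `(u w_{ω_i}) a = u (h_i ⊗ a) w_{ω_i}`. -/
lemma smul_smul_gen (a : A) (u : U A 𝔤) :
    a • u • gen b A i = u • el a (simpleCoroot b i : 𝔤) • gen b A i :=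
  GlobalWeyl.rightMul_smul_gen b a (simpleCoroot b i) u

/-- Every `h ⊗ a`, `h ∈ 𝔥`, acts on the generator as `ω_i(h) a`; so the right action of `𝔥 ⊗ A` on
`W_A(ω_i)` is the one obtained from the right `A`-module structure. -/
lemma cartan_smul_gen (a : A) (h : H) :
    el a (h : 𝔤) • gen b A i = fundamentalWeight b i h • a • gen b A i := by
  have hgen : a • gen b A i = el a (simpleCoroot b i : 𝔤) • gen b A i := act_gen b i a
  let φ : H →ₗ[ℂ] FundGlobalWeyl b A i :=
    { toFun := fun h => el a (h : 𝔤) • gen b A i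
      map_add' := fun h h' => by
        rw [show ((h + h' : H) : 𝔤) = h + h' from rfl, el_add_right, add_smul]
      map_smul' := fun z h => by
        rw [show ((z • h : H) : 𝔤) = z • (h : 𝔤) from rfl, el_smul_right, smul_assoc, RingHom.id_apply] }
  have key : φ = (fundamentalWeight b i).smulRight (a • gen b A i) := by
    refine b.toCoweightBasis.ext fun j => ?_
    rw [LinearMap.smulRight_apply, fundamentalWeight, Module.Basis.coord_apply,
      Module.Basis.repr_self, b.toCoweightBasis_apply]
    change el a (simpleCoroot b j : 𝔤) • gen b A i = _
    by_cases hj : j = i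
    · subst hj
      rw [Finsupp.single_eq_same, one_smul, hgen]
    · rw [Finsupp.single_eq_of_ne (Ne.symm hj), zero_smul]
      obtain ⟨e, f, he, hf, hef, -, -⟩ := exists_sl2 b j
      have hf0 : el (1 : A) f • gen b A i = 0 := by
        have := GlobalWeyl.pow_smul_gen b (A := A) (r := fundCoeff b i) j hf
        rw [fundCoeff, if_neg hj, pow_one] at this
        exact this
      have he0 : el a e • gen b A i = 0 := GlobalWeyl.nPlus_smul_gen b a he
      have h1 : (el a e * el (1 : A) f) • gen b A i = 0 := by rw [mul_smul, hf0, smul_zero]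
      rw [el_mul_el, hef, mul_one, add_smul, mul_smul, he0, smul_zero, zero_add] at h1
      exact h1
  exact LinearMap.congr_fun key h

instance : SMulCommClass A (U A 𝔤) (FundGlobalWeyl b A i) :=
  ⟨fun a u w => (rightAction b A i a).map_smul u w⟩

instance : SMulCommClass A ℂ (FundGlobalWeyl b A i) :=
  ⟨fun a z w => (rightAction b A i a).map_smul_of_tower z w⟩

instance : IsScalarTower ℂ A (FundGlobalWeyl b A i) :=
  ⟨fun z a w => by
    change rightAction b A i (z • a) w = z • rightAction b A i a w
    rw [map_smul, LinearMap.smul_apply]⟩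

end FundGlobalWeyl

/-- The fundamental local Weyl module `W_A(ω_i) ⊗_A A/I`. -/
def FundLocalWeyl (i : b.support) (I : Ideal A) : Type _ :=
  FundGlobalWeyl b A i ⊗[A] (A ⧸ I)

namespace FundLocalWeyl

variable (i : b.support) (I : Ideal A)

instance : AddCommGroup (FundLocalWeyl b A i I) :=
  inferInstanceAs (AddCommGroup (FundGlobalWeyl b A i ⊗[A] (A ⧸ I)))

/-- `𝔤 ⊗ A` acts on the first factor of `W_A(ω_i) ⊗_A A/I`. -/
instance : Module (U A 𝔤) (FundLocalWeyl b A i I) :=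
  inferInstanceAs (Module (U A 𝔤) (FundGlobalWeyl b A i ⊗[A] (A ⧸ I)))

instance : Module ℂ (FundLocalWeyl b A i I) :=
  inferInstanceAs (Module ℂ (FundGlobalWeyl b A i ⊗[A] (A ⧸ I)))

instance : IsScalarTower ℂ (U A 𝔤) (FundLocalWeyl b A i I) :=
  inferInstanceAs (IsScalarTower ℂ (U A 𝔤) (FundGlobalWeyl b A i ⊗[A] (A ⧸ I)))

/-- The generator `w_{ω_i, A/I} = w_{ω_i} ⊗ 1`. -/
def gen : FundLocalWeyl b A i I := FundGlobalWeyl.gen b A i ⊗ₜ[A] (1 : A ⧸ I)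

end FundLocalWeyl

end Fundamental

/-! ### The twisted modules `(V ⊗ A)_Δ` -/

section Twist

variable {𝔤 : Type*} [LieRing 𝔤] [LieAlgebra ℂ 𝔤] {A : Type*} [CommRing A] [Algebra ℂ A]

/-- The map `(𝔤 ⊗ A) ⊗ A → U(𝔤 ⊗ A) ⊗ A`, where the source is written as `(A ⊗ A) ⊗ 𝔤`. -/
def currentMap : ((A ⊗[ℂ] A) ⊗[ℂ] 𝔤) →ₗ[ℂ] (U A 𝔤 ⊗[ℂ] A) :=
  (UniversalEnvelopingAlgebra.ι ℂ (L := A ⊗[ℂ] 𝔤)).toLinearMap.rTensor A ∘ₗ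
    (TensorProduct.rightComm ℂ A A 𝔤).toLinearMap

lemma currentMap_tmul (a c : A) (x : 𝔤) :
    currentMap ((a ⊗ₜ[ℂ] c) ⊗ₜ[ℂ] x) = el a x ⊗ₜ[ℂ] c := rfl

lemma currentMap_mul_tmul (p q : A ⊗[ℂ] A) (x y : 𝔤) :
    currentMap ((p * q) ⊗ₜ[ℂ] ⁅x, y⁆) =
      currentMap (p ⊗ₜ[ℂ] x) * currentMap (q ⊗ₜ[ℂ] y) -
        currentMap (q ⊗ₜ[ℂ] y) * currentMap (p ⊗ₜ[ℂ] x) := by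
  induction p with
  | zero => simp
  | add p p' hp hp' =>
    rw [add_mul, TensorProduct.add_tmul, TensorProduct.add_tmul, map_add, map_add, hp, hp']
    noncomm_ring
  | tmul a c =>
    induction q with
    | zero => simp
    | add q q' hq hq' =>
      rw [mul_add, TensorProduct.add_tmul, TensorProduct.add_tmul, map_add, map_add, hq, hq']
      noncomm_ring
    | tmul a' c' =>
      rw [Algebra.TensorProduct.tmul_mul_tmul]
      simp only [currentMap_tmul, Algebra.TensorProduct.tmul_mul_tmul]
      rw [el_mul_el a a', TensorProduct.add_tmul, mul_comm c' c]
      abel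

/-- The algebra homomorphism `U(𝔤 ⊗ A) → U(𝔤 ⊗ A) ⊗ A` extending
`x ⊗ a ↦ ∑ (x ⊗ a') ⊗ a''`, where `Δ a = ∑ a' ⊗ a''`. -/
def twistHom (Δ : A →ₐ[ℂ] A ⊗[ℂ] A) : U A 𝔤 →ₐ[ℂ] (U A 𝔤 ⊗[ℂ] A) :=
  UniversalEnvelopingAlgebra.lift ℂ
    { (currentMap ∘ₗ Δ.toLinearMap.rTensor 𝔤 : A ⊗[ℂ] 𝔤 →ₗ[ℂ] U A 𝔤 ⊗[ℂ] A) with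
      map_lie' := by
        intro p q
        change currentMap (Δ.toLinearMap.rTensor 𝔤 ⁅p, q⁆) =
          ⁅currentMap (Δ.toLinearMap.rTensor 𝔤 p), currentMap (Δ.toLinearMap.rTensor 𝔤 q)⁆
        induction p with
        | zero => simp
        | add p p' hp hp' => simp only [add_lie, map_add, hp, hp']
        | tmul a x =>
          induction q with
          | zero => simp
          | add q q' hq hq' => simp only [lie_add, map_add, hq, hq']
          | tmul c y =>
            rw [LieAlgebra.ExtendScalars.bracket_tmul]
            simp only [LinearMap.rTensor_tmul, AlgHom.toLinearMap_apply, map_mul]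
            rw [currentMap_mul_tmul, LieRing.of_associative_ring_bracket] }

lemma twistHom_el (Δ : A →ₐ[ℂ] A ⊗[ℂ] A) (a : A) (x : 𝔤) :
    twistHom Δ (el a x) = currentMap (Δ a ⊗ₜ[ℂ] x) :=
  UniversalEnvelopingAlgebra.lift_ι_apply ..

variable (V : Type*) [AddCommGroup V] [Module ℂ V] [Module (U A 𝔤) V]
  [IsScalarTower ℂ (U A 𝔤) V]

/-- The natural action of `U(𝔤 ⊗ A) ⊗ A` on `V ⊗ A`. -/
def tensorAction : (U A 𝔤 ⊗[ℂ] A) →ₐ[ℂ] Module.End ℂ (V ⊗[ℂ] A) :=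
  Module.endTensorEndAlgHom.comp
    (Algebra.TensorProduct.map (Algebra.lsmul ℂ ℂ V) (Algebra.lsmul ℂ ℂ A))

lemma tensorAction_tmul (u : U A 𝔤) (a c : A) (v : V) :
    tensorAction V (u ⊗ₜ[ℂ] a) (v ⊗ₜ[ℂ] c) = (u • v) ⊗ₜ[ℂ] (a * c) := rfl

variable (A) in
/-- The action of `A` on the second factor of `V ⊗ A`. -/
def rightTensorAction : A →ₐ[ℂ] Module.End ℂ (V ⊗[ℂ] A) :=
  (Module.endTensorEndAlgHom.comp Algebra.TensorProduct.includeRight).comp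
    (Algebra.lsmul ℂ ℂ A)

/-- The `(𝔤 ⊗ A, A)`-bimodule `(V ⊗ A)_Δ`: the space `V ⊗ A` with
`(x ⊗ a)(v ⊗ c) = ∑ (x ⊗ a') v ⊗ a'' c` for `Δ a = ∑ a' ⊗ a''`, and `(v ⊗ c) a = v ⊗ c a`. -/
@[nolint unusedArguments]
def Twist (_Δ : A →ₐ[ℂ] A ⊗[ℂ] A) : Type _ := V ⊗[ℂ] A

namespace Twist

variable (Δ : A →ₐ[ℂ] A ⊗[ℂ] A)

instance : AddCommGroup (Twist V Δ) := inferInstanceAs (AddCommGroup (V ⊗[ℂ] A))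

instance : Module (U A 𝔤) (Twist V Δ) :=
  Module.compHom (V ⊗[ℂ] A) ((tensorAction V).comp (twistHom Δ)).toRingHom

instance : Module A (Twist V Δ) :=
  Module.compHom (V ⊗[ℂ] A) (rightTensorAction A V).toRingHom

variable {V Δ} in
/-- The pure tensor `v ⊗ c` of `(V ⊗ A)_Δ`. -/
def tmul (v : V) (c : A) : Twist V Δ := v ⊗ₜ[ℂ] c

variable {V Δ}

/-- The formula for the action of `𝔤 ⊗ A` on `(V ⊗ A)_Δ`. -/
lemma el_smul_tmul {ι : Type*} (s : Finset ι) (a' a'' : ι → A) (a : A)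
    (ha : Δ a = ∑ j ∈ s, a' j ⊗ₜ[ℂ] a'' j) (x : 𝔤) (v : V) (c : A) :
    el a x • (tmul v c : Twist V Δ) = ∑ j ∈ s, tmul (el (a' j) x • v) (a'' j * c) := by
  change tensorAction V (twistHom Δ (el a x)) (v ⊗ₜ[ℂ] c) = _
  rw [twistHom_el, ha, TensorProduct.sum_tmul, map_sum, map_sum, LinearMap.sum_apply]
  rfl

/-- The formula for the action of `A` on `(V ⊗ A)_Δ`. -/
lemma smul_tmul (a : A) (v : V) (c : A) : a • (tmul v c : Twist V Δ) = tmul v (a * c) := rfl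

end Twist

end Twist

/-! ### The algebra `ℂ[t_1^±, …, t_k^±, u_1, …, u_ℓ]` -/

section Laurent

variable (k ℓ : ℕ)

/-- The group algebra of `ℤ^k`, i.e. the Laurent polynomials in `t_1, …, t_k`. -/
abbrev TorusAlg : Type := AddMonoidAlgebra ℂ (Fin k → ℤ)

/-- `R_{k,ℓ} = ℂ[t_1^±, …, t_k^±, u_1, …, u_ℓ]`. -/
abbrev RAlg : Type := MvPolynomial (Fin ℓ) (TorusAlg k)

namespace RAlg

variable {k}

/-- The Laurent monomial `t^m = t_1^{m_1} ⋯ t_k^{m_k}`. -/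
def tPow (m : Fin k → ℤ) : RAlg k ℓ := MvPolynomial.C (AddMonoidAlgebra.single m 1)

lemma tPow_add (m n : Fin k → ℤ) : tPow ℓ (m + n) = tPow ℓ m * tPow ℓ n := by
  simp [tPow, ← map_mul, AddMonoidAlgebra.single_mul_single]

lemma tPow_zero : tPow ℓ (0 : Fin k → ℤ) = 1 := by
  simp [tPow, ← AddMonoidAlgebra.one_def]

/-- The invertible variable `t_s`. -/
def t (s : Fin k) : RAlg k ℓ := tPow ℓ (Pi.single s 1)

/-- The inverse of `t_s`. -/
def tInv (s : Fin k) : RAlg k ℓ := tPow ℓ (Pi.single s (-1))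

variable {ℓ} (k) in
/-- The variable `u_r`. -/
def u (r : Fin ℓ) : RAlg k ℓ := MvPolynomial.X r

lemma t_mul_tInv (s : Fin k) : t ℓ s * tInv ℓ s = 1 := by
  rw [t, tInv, ← tPow_add, ← Pi.single_add]
  simp [tPow_zero]

variable (k)

/-- The comultiplication `Δ_{k,ℓ}`: `t_s^{±1} ↦ t_s^{±1} ⊗ t_s^{±1}` and
`u_r ↦ u_r ⊗ 1 + 1 ⊗ u_r`. -/
def comul : RAlg k ℓ →ₐ[ℂ] RAlg k ℓ ⊗[ℂ] RAlg k ℓ :=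
  MvPolynomial.aevalTower
    (AddMonoidAlgebra.lift ℂ (RAlg k ℓ ⊗[ℂ] RAlg k ℓ) (Fin k → ℤ)
      { toFun := fun m => tPow ℓ m.toAdd ⊗ₜ[ℂ] tPow ℓ m.toAdd
        map_one' := by
          rw [toAdd_one, tPow_zero, Algebra.TensorProduct.one_def]
        map_mul' := fun m n => by
          rw [toAdd_mul, tPow_add, Algebra.TensorProduct.tmul_mul_tmul] })
    (fun r => u k r ⊗ₜ[ℂ] 1 + 1 ⊗ₜ[ℂ] u k r)

lemma comul_tPow (m : Fin k → ℤ) : comul k ℓ (tPow ℓ m) = tPow ℓ m ⊗ₜ[ℂ] tPow ℓ m := by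
  simp [comul, tPow]

lemma comul_t (s : Fin k) : comul k ℓ (t ℓ s) = t ℓ s ⊗ₜ[ℂ] t ℓ s := comul_tPow k ℓ _

lemma comul_tInv (s : Fin k) : comul k ℓ (tInv ℓ s) = tInv ℓ s ⊗ₜ[ℂ] tInv ℓ s :=
  comul_tPow k ℓ _

lemma comul_u (r : Fin ℓ) :
    comul k ℓ (u k r) = u k r ⊗ₜ[ℂ] 1 + 1 ⊗ₜ[ℂ] u k r := by
  simp [comul, u]

/-- The counit of `R_{k,ℓ}`: `t_s ↦ 1` and `u_r ↦ 0`. -/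
def counit : RAlg k ℓ →ₐ[ℂ] ℂ :=
  MvPolynomial.aevalTower (AddMonoidAlgebra.lift ℂ ℂ (Fin k → ℤ) 1) (fun _ => 0)

lemma counit_tPow (m : Fin k → ℤ) : counit k ℓ (tPow ℓ m) = 1 := by
  simp [counit, tPow]

lemma counit_u (r : Fin ℓ) : counit k ℓ (u k r) = 0 := by
  simp [counit, u]

variable {k ℓ} in
lemma hom_ext {B : Type*} [CommSemiring B] [Algebra ℂ B] {f g : RAlg k ℓ →ₐ[ℂ] B}
    (ht : ∀ m, f (tPow ℓ m) = g (tPow ℓ m)) (hu : ∀ r, f (u k r) = g (u k r)) : f = g := by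
  refine MvPolynomial.algHom_ext' (AddMonoidAlgebra.algHom_ext (fun m => ht m) ?_) hu
  ext

/-- `R_{k,ℓ}` is a bialgebra with the comultiplication `Δ_{k,ℓ}`. -/
@[reducible]
def bialgebra : Bialgebra ℂ (RAlg k ℓ) :=
  Bialgebra.ofAlgHom (comul k ℓ) (counit k ℓ)
    (by
      refine hom_ext (B := RAlg k ℓ ⊗[ℂ] (RAlg k ℓ ⊗[ℂ] RAlg k ℓ)) ?_ ?_
      · intro m
        simp [comul_tPow]
      · intro r
        simp [comul_u, TensorProduct.add_tmul, TensorProduct.tmul_add,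
          Algebra.TensorProduct.one_def, add_assoc])
    (by
      apply hom_ext
      · intro m
        simp [comul_tPow, counit_tPow]
      · intro r
        simp [comul_u, counit_u])
    (by
      refine hom_ext (B := RAlg k ℓ ⊗[ℂ] ℂ) ?_ ?_
      · intro m
        simp [comul_tPow, counit_tPow]
      · intro r
        simp [comul_u, counit_u])

/-- The ideal `I` generated by `t_1 - 1, …, t_k - 1, u_1, …, u_ℓ`. -/
def pointIdeal : Ideal (RAlg k ℓ) :=
  Ideal.span (Set.range (fun s => t ℓ s - 1) ∪ Set.range (u k))

end RAlg

end Laurent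

end WeylModules

end

noncomputable section

namespace WeylModules

attribute [local instance] LieRing.ofAssociativeRing

/-! ### Shearing automorphisms attached to twists -/

section Shear

variable {𝔤 : Type*} [LieRing 𝔤] [LieAlgebra ℂ 𝔤] {A : Type*} [CommRing A] [Algebra ℂ A]

/-! Write `Δ(a) = ∑ a' ⊗ a''`, let `ε` be the counit with kernel `I`, and let `w`, `v` be the
generators of the global Weyl module and of the local one at `I`. Since `Δ(1) = 1 ⊗ 1`, the vector
`v ⊗ 1` inherits the defining relations of `w`, which gives a map `toTwist` with `w ↦ v ⊗ 1`. It
respects the right action because `h_i ⊗ a` acts on `v` by `ε(a)`, so that `(h_i ⊗ a)(v ⊗ 1) = v ⊗ ∑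
ε(a') a'' = v ⊗ a`.

The inverse is built by untwisting with the antipode `S`, and no basis or dimension count is needed.
Put `τ(a) = ∑ a' ⊗ S(a'')`. The same argument with `τ` in place of `Δ`, followed by the right action
`W ⊗ A → W`, gives `twistedEnd` on the global module, `u w ↦ τ(u) w`. It turns right multiplication
by `a` into the scalar `∑ a' S(a'') = ε(a)`, hence factors through the local module (`twistedLift`),
and it extends to `V ⊗ A` by letting the second factor act on the right (`ofTwist`).

The twists cancel because `a ⊗ c ↦ Δ(a)(1 ⊗ c)` and `a ⊗ c ↦ τ(a)(1 ⊗ c)` are mutually inverse on `A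
⊗ A`. One composite, lifted to `U(𝔤 ⊗ A) ⊗ A` (`envShear_twistHom`), makes `ofTwist` linear over
`U(𝔤 ⊗ A)`; the other shows that `v ⊗ 1` generates the twisted bimodule (`Twist.hom_ext_of_cyclic`).
The two maps exchange generators, so they are inverse to each other. -/

/-- The endomorphism `a ⊗ c ↦ Δ(a) (1 ⊗ c)` of `A ⊗ A`. -/
def shear (Δ : A →ₐ[ℂ] A ⊗[ℂ] A) : A ⊗[ℂ] A →ₐ[ℂ] A ⊗[ℂ] A :=
  Algebra.TensorProduct.lift Δ Algebra.TensorProduct.includeRight fun _ _ => Commute.all _ _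

/-- Commutativity of `A` makes the second factor central; this is what lets the left and right
actions on a twist commute. -/
lemma commute_one_tmul {R : Type*} [Ring R] [Algebra ℂ R] (p : R ⊗[ℂ] A) (c : A) :
    Commute p ((1 : R) ⊗ₜ[ℂ] c) := by
  induction p with
  | zero => exact Commute.zero_left _
  | add p q hp hq => exact hp.add_left hq
  | tmul u a =>
    rw [commute_iff_eq, Algebra.TensorProduct.tmul_mul_tmul, Algebra.TensorProduct.tmul_mul_tmul,
      mul_one, one_mul, mul_comm]

/-- The endomorphism `u ⊗ c ↦ Δ(u) (1 ⊗ c)` of `U(𝔤 ⊗ A) ⊗ A`. -/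
def envShear (Δ : A →ₐ[ℂ] A ⊗[ℂ] A) : U A 𝔤 ⊗[ℂ] A →ₐ[ℂ] U A 𝔤 ⊗[ℂ] A :=
  Algebra.TensorProduct.lift (twistHom Δ) Algebra.TensorProduct.includeRight
    fun _ c => commute_one_tmul _ c

lemma envShear_tmul (Δ : A →ₐ[ℂ] A ⊗[ℂ] A) (u : U A 𝔤) (c : A) :
    envShear Δ (u ⊗ₜ[ℂ] c) = twistHom Δ u * (1 ⊗ₜ[ℂ] c) :=
  Algebra.TensorProduct.lift_tmul ..

lemma currentMap_mul_one_tmul (p : A ⊗[ℂ] A) (c : A) (x : 𝔤) :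
    currentMap ((p * (1 ⊗ₜ[ℂ] c)) ⊗ₜ[ℂ] x) = currentMap (p ⊗ₜ[ℂ] x) * (1 ⊗ₜ[ℂ] c) := by
  induction p with
  | zero => simp
  | add p q hp hq => simp only [add_mul, TensorProduct.add_tmul, map_add, hp, hq]
  | tmul a d => simp [currentMap_tmul, Algebra.TensorProduct.tmul_mul_tmul]

/-- Reduces identities between the shears of `U(𝔤 ⊗ A) ⊗ A` to identities between the shears of `A ⊗
A`. -/
lemma envShear_currentMap (Δ : A →ₐ[ℂ] A ⊗[ℂ] A) (p : A ⊗[ℂ] A) (x : 𝔤) :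
    envShear Δ (currentMap (p ⊗ₜ[ℂ] x)) = currentMap (shear Δ p ⊗ₜ[ℂ] x) := by
  induction p with
  | zero => simp
  | add p q hp hq => simp only [TensorProduct.add_tmul, map_add, hp, hq]
  | tmul a c =>
    rw [currentMap_tmul, envShear_tmul, twistHom_el, ← currentMap_mul_one_tmul]
    rfl

/-- The cancellation of twists. Both sides are algebra homomorphisms in `u`, so it suffices to
compare them on the elements `x ⊗ a`, where the hypothesis on `A ⊗ A` applies. -/
lemma envShear_twistHom {Δ τ : A →ₐ[ℂ] A ⊗[ℂ] A}
    (h : (shear τ).comp Δ = Algebra.TensorProduct.includeLeft) (u : U A 𝔤) :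
    envShear τ (twistHom Δ u) = u ⊗ₜ[ℂ] 1 := by
  suffices (envShear τ).comp (twistHom Δ) =
      (Algebra.TensorProduct.includeLeft : U A 𝔤 →ₐ[ℂ] U A 𝔤 ⊗[ℂ] A) from
    DFunLike.congr_fun this u
  apply UniversalEnvelopingAlgebra.hom_ext
  ext p
  change envShear τ (twistHom Δ (UniversalEnvelopingAlgebra.ι ℂ p)) =
    UniversalEnvelopingAlgebra.ι ℂ p ⊗ₜ[ℂ] 1
  induction p with
  | zero => simp
  | add p q hp hq => simp only [map_add, hp, hq, TensorProduct.add_tmul]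
  | tmul a x =>
    change envShear τ (twistHom Δ (el a x)) = el a x ⊗ₜ[ℂ] 1
    rw [twistHom_el, envShear_currentMap, ← AlgHom.comp_apply, h]
    rfl

/-- The action of `U(𝔤 ⊗ A) ⊗ A` on a `(𝔤 ⊗ A, A)`-bimodule. -/
def bimoduleAction (W : Type*) [AddCommGroup W] [Module ℂ W] [Module (U A 𝔤) W] [Module A W]
    [IsScalarTower ℂ (U A 𝔤) W] [IsScalarTower ℂ A W] [SMulCommClass A (U A 𝔤) W] :
    U A 𝔤 ⊗[ℂ] A →ₐ[ℂ] Module.End ℂ W :=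
  Algebra.TensorProduct.lift (Algebra.lsmul ℂ ℂ W) (Algebra.lsmul ℂ ℂ W)
    fun u a => (commute_iff_eq _ _).2 (LinearMap.ext fun w => (smul_comm a u w).symm)

/-! ### Extending linear maps along the right action. -/

section Bimodule

variable {W : Type*} [AddCommGroup W] [Module ℂ W] [Module (U A 𝔤) W] [Module A W]
    [IsScalarTower ℂ (U A 𝔤) W] [IsScalarTower ℂ A W] [SMulCommClass A (U A 𝔤) W]

lemma bimoduleAction_tmul (u : U A 𝔤) (a : A) (w : W) :
    bimoduleAction W (u ⊗ₜ[ℂ] a) w = u • a • w := by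
  rw [bimoduleAction, Algebra.TensorProduct.lift_tmul]
  rfl

/-- The map `V ⊗ A → W`, `v ⊗ c ↦ θ(v) c`, induced by a linear map `θ : V → W`. -/
def extendRight {V : Type*} [AddCommGroup V] [Module ℂ V] (θ : V →ₗ[ℂ] W) : V ⊗[ℂ] A →ₗ[ℂ] W :=
  TensorProduct.lift ((Algebra.lsmul ℂ ℂ W).toLinearMap.flip ∘ₗ θ)

lemma extendRight_tmul {V : Type*} [AddCommGroup V] [Module ℂ V] (θ : V →ₗ[ℂ] W) (v : V) (c : A) :
    extendRight θ (v ⊗ₜ[ℂ] c) = c • θ v := rfl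

/-- If `θ` intertwines the action of `U(𝔤 ⊗ A)` on `V` with its `φ`-twisted action on `W`, then
`extendRight θ` intertwines the actions of `U(𝔤 ⊗ A) ⊗ A`. -/
lemma extendRight_tensorAction {V : Type*} [AddCommGroup V] [Module ℂ V] [Module (U A 𝔤) V]
    [IsScalarTower ℂ (U A 𝔤) V] (θ : V →ₗ[ℂ] W) (φ : U A 𝔤 →ₐ[ℂ] U A 𝔤 ⊗[ℂ] A)
    (hθ : ∀ u v, θ (u • v) = bimoduleAction W (φ u) (θ v)) (u : U A 𝔤) (d : A) (z : V ⊗[ℂ] A) :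
    extendRight θ (tensorAction V (u ⊗ₜ[ℂ] d) z) =
      bimoduleAction W (φ u * (1 ⊗ₜ[ℂ] d)) (extendRight θ z) := by
  induction z with
  | zero => simp
  | add y z hy hz => simp only [map_add, hy, hz]
  | tmul v c =>
    -- Once the right action is written through `1 ⊗ a`, the claim becomes an identity in `U(𝔤 ⊗ A)
    -- ⊗ A`, settled by centrality of `1 ⊗ a`.
    have h (a : A) (w : W) : a • w = bimoduleAction W ((1 : U A 𝔤) ⊗ₜ[ℂ] a) w := by
      rw [bimoduleAction_tmul, one_smul]
    rw [tensorAction_tmul, extendRight_tmul, extendRight_tmul, hθ, h, h, ← Module.End.mul_apply,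
      ← Module.End.mul_apply, ← map_mul, ← map_mul, mul_assoc,
      Algebra.TensorProduct.tmul_mul_tmul, one_mul, (commute_one_tmul (φ u) (d * c)).eq]

/-- The untwisted case `φ(u) = u ⊗ 1`: the right action map `W ⊗ A → W` is equivariant. -/
lemma extendRight_id_tensorAction (r : U A 𝔤 ⊗[ℂ] A) (z : W ⊗[ℂ] A) :
    extendRight LinearMap.id (tensorAction W r z) =
      bimoduleAction W r (extendRight LinearMap.id z) := by
  induction r with
  | zero => simp
  | add r s hr hs => simp only [map_add, LinearMap.add_apply, hr, hs]
  | tmul u d =>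
    rw [extendRight_tensorAction LinearMap.id Algebra.TensorProduct.includeLeft,
      Algebra.TensorProduct.includeLeft_apply, Algebra.TensorProduct.tmul_mul_tmul, mul_one,
      one_mul]
    intro u v
    rw [Algebra.TensorProduct.includeLeft_apply, bimoduleAction_tmul, one_smul]
    rfl

/-- The shear appears because `u ⊗ d` is carried to `τ(u)(1 ⊗ d)`, and both sides are additive in
`r`. -/
lemma extendRight_tensorAction_envShear {V : Type*} [AddCommGroup V] [Module ℂ V]
    [Module (U A 𝔤) V] [IsScalarTower ℂ (U A 𝔤) V] (θ : V →ₗ[ℂ] W) (τ : A →ₐ[ℂ] A ⊗[ℂ] A)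
    (hθ : ∀ (u : U A 𝔤) v, θ (u • v) = bimoduleAction W (twistHom τ u) (θ v))
    (r : U A 𝔤 ⊗[ℂ] A) (z : V ⊗[ℂ] A) :
    extendRight θ (tensorAction V r z) = bimoduleAction W (envShear τ r) (extendRight θ z) := by
  induction r with
  | zero => simp
  | add r s hr hs => simp only [map_add, LinearMap.add_apply, hr, hs]
  | tmul u d => rw [extendRight_tensorAction θ (twistHom τ) hθ, envShear_tmul]

end Bimodule

end Shear

/-! ### The bimodule structure of a twist and its generation by one vector. -/

namespace Twist

variable {𝔤 : Type*} [LieRing 𝔤] [LieAlgebra ℂ 𝔤] {A : Type*} [CommRing A] [Algebra ℂ A]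
  {V : Type*} [AddCommGroup V] [Module ℂ V] [Module (U A 𝔤) V] [IsScalarTower ℂ (U A 𝔤) V]
  {Δ τ : A →ₐ[ℂ] A ⊗[ℂ] A}

instance : Module ℂ (Twist V Δ) := inferInstanceAs (Module ℂ (V ⊗[ℂ] A))

variable (V Δ) in
/-- The underlying space of `(V ⊗ A)_Δ`. -/
def untwist : Twist V Δ ≃ₗ[ℂ] V ⊗[ℂ] A := LinearEquiv.refl ℂ _

lemma untwist_tmul (v : V) (c : A) : untwist V Δ (tmul v c) = v ⊗ₜ[ℂ] c := rfl

lemma untwist_smul (u : U A 𝔤) (z : Twist V Δ) :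
    untwist V Δ (u • z) = tensorAction V (twistHom Δ u) (untwist V Δ z) := rfl

instance : IsScalarTower ℂ (U A 𝔤) (Twist V Δ) :=
  ⟨fun z u t => (untwist V Δ).injective <| by
    rw [untwist_smul, map_smul, map_smul, map_smul, LinearMap.smul_apply, untwist_smul]⟩

variable (𝔤) in
lemma untwist_smul_right (a : A) (z : Twist V Δ) :
    untwist V Δ (a • z) = tensorAction V ((1 : U A 𝔤) ⊗ₜ[ℂ] a) (untwist V Δ z) := by
  change rightTensorAction A V a (untwist V Δ z) = _
  congr 1
  refine TensorProduct.ext' fun v c => ?_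
  rw [tensorAction_tmul, one_smul]
  rfl

instance : SMulCommClass A (U A 𝔤) (Twist V Δ) :=
  ⟨fun a u z => (untwist V Δ).injective <| by
    rw [untwist_smul_right 𝔤, untwist_smul, untwist_smul, untwist_smul_right 𝔤,
      ← Module.End.mul_apply, ← Module.End.mul_apply, ← map_mul, ← map_mul,
      (commute_one_tmul (twistHom Δ u) a).eq]⟩

lemma tensorAction_envShear (u : U A 𝔤) (a : A) (z : Twist V Δ) :
    tensorAction V (envShear Δ (u ⊗ₜ[ℂ] a)) (untwist V Δ z) = untwist V Δ (u • a • z) := by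
  rw [envShear_tmul, map_mul, untwist_smul, untwist_smul_right 𝔤, Module.End.mul_apply]

/-- If `V` is generated by `v` then `(V ⊗ A)_Δ` is generated by `v ⊗ 1` as a bimodule. -/
lemma hom_ext_of_cyclic (h : (shear Δ).comp τ = Algebra.TensorProduct.includeLeft) {v : V}
    (hv : ∀ y : V, ∃ u : U A 𝔤, y = u • v) {X : Type*} [AddCommGroup X] [Module (U A 𝔤) X]
    [Module A X] {f g : Twist V Δ →+ X}
    (hfu : ∀ (u : U A 𝔤) z, f (u • z) = u • f z) (hfa : ∀ (a : A) z, f (a • z) = a • f z)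
    (hgu : ∀ (u : U A 𝔤) z, g (u • z) = u • g z) (hga : ∀ (a : A) z, g (a • z) = a • g z)
    (hfg : f (tmul v 1) = g (tmul v 1)) : f = g := by
  -- Both maps are moved to `V ⊗ A`, where the action of all of `U(𝔤 ⊗ A) ⊗ A` is available.
  let F : V ⊗[ℂ] A →+ X := f.comp (untwist V Δ).symm.toLinearMap.toAddMonoidHom
  let G : V ⊗[ℂ] A →+ X := g.comp (untwist V Δ).symm.toLinearMap.toAddMonoidHom
  -- The sheared action of `u ⊗ a` is the bimodule action of `u` and `a`, so agreement at `z`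
  -- spreads to everything reached by sheared elements.
  have key (s : U A 𝔤 ⊗[ℂ] A) (z : Twist V Δ) (hz : f z = g z) :
      F (tensorAction V (envShear Δ s) (untwist V Δ z)) =
        G (tensorAction V (envShear Δ s) (untwist V Δ z)) := by
    induction s with
    | zero => simp
    | add s t hs ht => simp only [map_add, LinearMap.add_apply, hs, ht]
    | tmul u a =>
      rw [tensorAction_envShear]
      change f (u • a • z) = g (u • a • z)
      rw [hfu, hgu, hfa, hga, hz]
  suffices h : F = G from AddMonoidHom.ext fun z => DFunLike.congr_fun h (untwist V Δ z)
  ext z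
  induction z with
  | zero => simp
  | add y z hy hz => simp only [map_add, hy, hz]
  | tmul y c =>
    obtain ⟨u, rfl⟩ := hv y
    -- Shearing `τ(u)` by `Δ` gives `u ⊗ 1`, so every `u v ⊗ c` is reached from `(v ⊗ 1) c`.
    have h1 : (u • v) ⊗ₜ[ℂ] c =
        tensorAction V (envShear Δ (twistHom τ u)) (untwist V Δ (c • tmul v 1)) := by
      rw [envShear_twistHom h, smul_tmul, mul_one, untwist_tmul, tensorAction_tmul, one_mul]
    rw [h1]
    exact key _ _ (by rw [hfa, hga, hfg])

end Twist

/-! ### Homomorphisms from Weyl modules to twisted modules -/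

namespace Twist

section

variable {𝔤 : Type*} [LieRing 𝔤] [LieAlgebra ℂ 𝔤] {A : Type*} [CommRing A] [Algebra ℂ A]
  {V : Type*} [AddCommGroup V] [Module ℂ V] [Module (U A 𝔤) V] [IsScalarTower ℂ (U A 𝔤) V]
  {Δ : A →ₐ[ℂ] A ⊗[ℂ] A}

lemma tensorAction_currentMap_eq_zero {v : V} {x : 𝔤} (h : ∀ a : A, el a x • v = 0)
    (p : A ⊗[ℂ] A) (c : A) : tensorAction V (currentMap (p ⊗ₜ[ℂ] x)) (v ⊗ₜ[ℂ] c) = 0 := by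
  induction p with
  | zero => simp
  | add p q hp hq => simp only [TensorProduct.add_tmul, map_add, LinearMap.add_apply, hp, hq,
      add_zero]
  | tmul a d => rw [currentMap_tmul, tensorAction_tmul, h, TensorProduct.zero_tmul]

lemma smul_tmul_of_twistHom_eq {u : U A 𝔤} (hu : twistHom Δ u = u ⊗ₜ[ℂ] 1) (v : V) (c : A) :
    u • (tmul v c : Twist V Δ) = tmul (u • v) c := by
  apply (untwist V Δ).injective
  rw [untwist_smul, hu, untwist_tmul, tensorAction_tmul, one_mul, untwist_tmul]

lemma twistHom_el_one (x : 𝔤) : twistHom Δ (el 1 x) = el 1 x ⊗ₜ[ℂ] 1 := by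
  rw [twistHom_el, map_one, Algebra.TensorProduct.one_def, currentMap_tmul]

end

variable {𝔤 : Type*} [LieRing 𝔤] [LieAlgebra ℂ 𝔤] [FiniteDimensional ℂ 𝔤]
  [LieAlgebra.IsSimple ℂ 𝔤] {H : LieSubalgebra ℂ 𝔤} [H.IsCartanSubalgebra]
  {b : (LieAlgebra.IsKilling.rootSystem H).Base}
  {A : Type*} [CommRing A] [Algebra ℂ A]
  {V : Type*} [AddCommGroup V] [Module ℂ V] [Module (U A 𝔤) V] [IsScalarTower ℂ (U A 𝔤) V]

/-- If `v` satisfies the defining relations of a global Weyl module, so does `v ⊗ 1`. -/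
lemma relations_smul_tmul_one (Δ : A →ₐ[ℂ] A ⊗[ℂ] A) {r : b.support → ℕ} {v : V}
    (hv : ∀ u ∈ relations b A r, u • v = 0) (u : U A 𝔤) (hu : u ∈ relations b A r) :
    u • (tmul v 1 : Twist V Δ) = 0 := by
  -- The Cartan and power relations involve only `𝔤 ⊗ 1`, on which the twist is trivial. The
  -- relations for `𝔫⁺ ⊗ A` hold because every first factor of `Δ(a)` is again in `A`.
  have of_eq (hΔ : twistHom Δ u = u ⊗ₜ[ℂ] 1) : u • (tmul v 1 : Twist V Δ) = 0 := by
    rw [smul_tmul_of_twistHom_eq hΔ, hv u hu]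
    exact TensorProduct.zero_tmul _ _
  rcases hu with (⟨a, x, hx, rfl⟩ | ⟨h, rfl⟩) | ⟨i, f, -, rfl⟩
  · apply (untwist V Δ).injective
    rw [untwist_smul, twistHom_el, untwist_tmul, map_zero]
    exact tensorAction_currentMap_eq_zero (fun c => hv _ (Or.inl (Or.inl ⟨c, x, hx, rfl⟩))) _ _
  · apply of_eq
    rw [map_sub, twistHom_el_one, AlgHom.commutes, TensorProduct.sub_tmul]
    rfl
  · apply of_eq
    rw [map_pow, twistHom_el_one, Algebra.TensorProduct.tmul_pow, one_pow]

end Twist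

/-! ### The two mutually inverse maps between the global module and the twisted local one. -/

section Comparison

variable {𝔤 : Type*} [LieRing 𝔤] [LieAlgebra ℂ 𝔤] [FiniteDimensional ℂ 𝔤]
  [LieAlgebra.IsSimple ℂ 𝔤] {H : LieSubalgebra ℂ 𝔤} [H.IsCartanSubalgebra]
  (b : (LieAlgebra.IsKilling.rootSystem H).Base) (i : b.support)
  {A : Type*} [CommRing A] [Algebra ℂ A]

lemma FundGlobalWeyl.smul_gen (a : A) :
    a • FundGlobalWeyl.gen b A i = el a (simpleCoroot b i : 𝔤) • FundGlobalWeyl.gen b A i :=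
  FundGlobalWeyl.act_gen b i a

lemma FundGlobalWeyl.relations_smul_gen (u : U A 𝔤) (hu : u ∈ relations b A (fundCoeff b i)) :
    u • FundGlobalWeyl.gen b A i = 0 :=
  GlobalWeyl.smul_gen_eq_zero b hu

lemma FundGlobalWeyl.exists_smul_gen (w : FundGlobalWeyl b A i) :
    ∃ u : U A 𝔤, w = u • FundGlobalWeyl.gen b A i :=
  GlobalWeyl.exists_smul_gen b w

namespace FundLocalWeyl

variable (I : Ideal A)

lemma smul_gen (u : U A 𝔤) :
    u • gen b A i I = (u • FundGlobalWeyl.gen b A i) ⊗ₜ[A] (1 : A ⧸ I) := rfl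

lemma relations_smul_gen (u : U A 𝔤) (hu : u ∈ relations b A (fundCoeff b i)) :
    u • gen b A i I = 0 := by
  rw [smul_gen, FundGlobalWeyl.relations_smul_gen b i u hu]
  exact TensorProduct.zero_tmul _ _

/-- A class in `A/I` lifts to `A` and moves across the tensor sign, and the global module is cyclic.
-/
lemma exists_smul_gen (v : FundLocalWeyl b A i I) : ∃ u : U A 𝔤, v = u • gen b A i I := by
  change FundGlobalWeyl b A i ⊗[A] (A ⧸ I) at v
  induction v with
  | zero => exact ⟨0, (zero_smul (U A 𝔤) (gen b A i I)).symm⟩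
  | add v w hv hw =>
    obtain ⟨x, rfl⟩ := hv
    obtain ⟨y, rfl⟩ := hw
    exact ⟨x + y, (add_smul _ _ _).symm⟩
  | tmul w q =>
    obtain ⟨a, rfl⟩ := Ideal.Quotient.mk_surjective q
    obtain ⟨u, hu⟩ := FundGlobalWeyl.exists_smul_gen b i (a • w)
    refine ⟨u, ?_⟩
    rw [smul_gen, ← hu, TensorProduct.smul_tmul, Algebra.smul_def, mul_one]
    rfl

/-- The subalgebra `h_i ⊗ A` acts on the generator of the local Weyl module at the kernel of a
character `ε` by `ε`. -/
lemma coroot_smul_gen {ε : A →ₐ[ℂ] ℂ} (hI : ∀ a, ε a = 0 → a ∈ I) (a : A) :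
    el a (simpleCoroot b i : 𝔤) • gen b A i I = ε a • gen b A i I := by
  have ha : a - algebraMap ℂ A (ε a) ∈ I := hI _ (by simp)
  rw [smul_gen, ← FundGlobalWeyl.smul_gen, TensorProduct.smul_tmul]
  change _ = (ε a • FundGlobalWeyl.gen b A i) ⊗ₜ[A] (1 : A ⧸ I)
  rw [← algebraMap_smul A (ε a) (FundGlobalWeyl.gen b A i), TensorProduct.smul_tmul]
  congr 1
  rw [← sub_eq_zero, ← sub_smul, Algebra.smul_def, mul_one]
  exact Ideal.Quotient.eq_zero_iff_mem.2 ha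

end FundLocalWeyl

/-- The homomorphism `W_A(ω_i) → (W_A(ω_i) ⊗_A A/I ⊗ A)_Δ`. -/
def toTwist (Δ : A →ₐ[ℂ] A ⊗[ℂ] A) (I : Ideal A) :
    FundGlobalWeyl b A i →ₗ[U A 𝔤] Twist (FundLocalWeyl b A i I) Δ :=
  GlobalWeyl.desc b _ (Twist.tmul (FundLocalWeyl.gen b A i I) 1)
    (Twist.relations_smul_tmul_one Δ (FundLocalWeyl.relations_smul_gen b i I))

lemma toTwist_gen (Δ : A →ₐ[ℂ] A ⊗[ℂ] A) (I : Ideal A) :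
    toTwist b i Δ I (FundGlobalWeyl.gen b A i) = Twist.tmul (FundLocalWeyl.gen b A i I) 1 :=
  GlobalWeyl.desc_gen ..

/-- Since `h_i ⊗ a` acts on the local generator by `ε(a)`, only `(ε ⊗ id)(p)` survives; for `p =
Δ(a)` the counit axiom makes it `a`. -/
lemma tensorAction_coroot {I : Ideal A} {ε : A →ₐ[ℂ] ℂ} (hI : ∀ a, ε a = 0 → a ∈ I)
    (p : A ⊗[ℂ] A) :
    tensorAction (FundLocalWeyl b A i I) (currentMap (p ⊗ₜ[ℂ] (simpleCoroot b i : 𝔤)))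
        (FundLocalWeyl.gen b A i I ⊗ₜ[ℂ] 1) =
      FundLocalWeyl.gen b A i I ⊗ₜ[ℂ]
        Algebra.TensorProduct.lid ℂ A (Algebra.TensorProduct.map ε (AlgHom.id ℂ A) p) := by
  induction p with
  | zero => simp
  | add p q hp hq =>
    simp only [TensorProduct.add_tmul, map_add, LinearMap.add_apply, hp, hq, TensorProduct.tmul_add]
  | tmul a c =>
    rw [currentMap_tmul, tensorAction_tmul, FundLocalWeyl.coroot_smul_gen b i I hI, mul_one,
      TensorProduct.smul_tmul, Algebra.TensorProduct.map_tmul, Algebra.TensorProduct.lid_tmul]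
    rfl

lemma toTwist_smul_right {Δ : A →ₐ[ℂ] A ⊗[ℂ] A} {I : Ideal A} {ε : A →ₐ[ℂ] ℂ}
    (hI : ∀ a, ε a = 0 → a ∈ I)
    (hε : ∀ a, Algebra.TensorProduct.lid ℂ A
      (Algebra.TensorProduct.map ε (AlgHom.id ℂ A) (Δ a)) = a)
    (a : A) (w : FundGlobalWeyl b A i) : toTwist b i Δ I (a • w) = a • toTwist b i Δ I w := by
  obtain ⟨u, rfl⟩ := FundGlobalWeyl.exists_smul_gen b i w
  have h : el a (simpleCoroot b i : 𝔤) •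
      (Twist.tmul (FundLocalWeyl.gen b A i I) 1 : Twist (FundLocalWeyl b A i I) Δ) =
        a • Twist.tmul (FundLocalWeyl.gen b A i I) 1 := by
    apply (Twist.untwist _ Δ).injective
    rw [Twist.untwist_smul, twistHom_el, Twist.untwist_tmul, tensorAction_coroot b i hI, hε,
      Twist.smul_tmul, mul_one, Twist.untwist_tmul]
  rw [FundGlobalWeyl.smul_smul_gen, map_smul, map_smul, map_smul, toTwist_gen, h,
    ← smul_comm a u]

/-- The homomorphism `W_A(ω_i) → (W_A(ω_i) ⊗ A)_τ` that sends the generator to `w_{ω_i} ⊗ 1`. -/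
def toTwistSelf (τ : A →ₐ[ℂ] A ⊗[ℂ] A) :
    FundGlobalWeyl b A i →ₗ[U A 𝔤] Twist (FundGlobalWeyl b A i) τ :=
  GlobalWeyl.desc b _ (Twist.tmul (FundGlobalWeyl.gen b A i) 1)
    (Twist.relations_smul_tmul_one τ (FundGlobalWeyl.relations_smul_gen b i))

lemma toTwistSelf_gen (τ : A →ₐ[ℂ] A ⊗[ℂ] A) :
    toTwistSelf b i τ (FundGlobalWeyl.gen b A i) = Twist.tmul (FundGlobalWeyl.gen b A i) 1 :=
  GlobalWeyl.desc_gen ..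

/-- The map `u w_{ω_i} ↦ τ(u) w_{ω_i}` on the global Weyl module. -/
def twistedEnd (τ : A →ₐ[ℂ] A ⊗[ℂ] A) : FundGlobalWeyl b A i →ₗ[ℂ] FundGlobalWeyl b A i :=
  extendRight LinearMap.id ∘ₗ (Twist.untwist _ τ).toLinearMap ∘ₗ
    (toTwistSelf b i τ).restrictScalars ℂ

lemma twistedEnd_apply (τ : A →ₐ[ℂ] A ⊗[ℂ] A) (w : FundGlobalWeyl b A i) :
    twistedEnd b i τ w = extendRight LinearMap.id (Twist.untwist _ τ (toTwistSelf b i τ w)) := rfl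

lemma twistedEnd_gen (τ : A →ₐ[ℂ] A ⊗[ℂ] A) :
    twistedEnd b i τ (FundGlobalWeyl.gen b A i) = FundGlobalWeyl.gen b A i := by
  rw [twistedEnd_apply, toTwistSelf_gen, Twist.untwist_tmul, extendRight_tmul, one_smul,
    LinearMap.id_apply]

lemma twistedEnd_smul (τ : A →ₐ[ℂ] A ⊗[ℂ] A) (u : U A 𝔤) (w : FundGlobalWeyl b A i) :
    twistedEnd b i τ (u • w) =
      bimoduleAction _ (twistHom τ u) (twistedEnd b i τ w) := by
  rw [twistedEnd_apply, twistedEnd_apply, map_smul, Twist.untwist_smul,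
    extendRight_id_tensorAction]

/-- On the generator `h_i ⊗ a` coincides with the right action of `a`, so both tensor factors act on
the right and multiply. -/
lemma bimoduleAction_coroot (p : A ⊗[ℂ] A) :
    bimoduleAction _ (currentMap (p ⊗ₜ[ℂ] (simpleCoroot b i : 𝔤))) (FundGlobalWeyl.gen b A i) =
      Algebra.TensorProduct.lmul' ℂ p • FundGlobalWeyl.gen b A i := by
  induction p with
  | zero => simp
  | add p q hp hq =>
    simp only [TensorProduct.add_tmul, map_add, LinearMap.add_apply, hp, hq, add_smul]
  | tmul a c =>
    rw [currentMap_tmul, bimoduleAction_tmul, ← smul_comm c, ← FundGlobalWeyl.smul_gen, smul_smul,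
      Algebra.TensorProduct.lmul'_apply_tmul, mul_comm]

/-- Right multiplication by `a` inserts `h_i ⊗ a` before the generator; after twisting it acts by
the product of the factors of `τ(a)`, which is `ε(a)`. This is why the map descends to the local
module. -/
lemma twistedEnd_smul_right {τ : A →ₐ[ℂ] A ⊗[ℂ] A} {ε : A →ₐ[ℂ] ℂ}
    (hτ : ∀ a, Algebra.TensorProduct.lmul' ℂ (τ a) = algebraMap ℂ A (ε a))
    (a : A) (w : FundGlobalWeyl b A i) :
    twistedEnd b i τ (a • w) = ε a • twistedEnd b i τ w := by
  obtain ⟨u, rfl⟩ := FundGlobalWeyl.exists_smul_gen b i w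
  rw [FundGlobalWeyl.smul_smul_gen, twistedEnd_smul, twistedEnd_smul, twistedEnd_smul,
    twistHom_el, twistedEnd_gen, bimoduleAction_coroot, hτ, algebraMap_smul, map_smul]

/-- The map induced by `twistedEnd` on the local Weyl module at the kernel of `ε`. -/
def twistedLift {τ : A →ₐ[ℂ] A ⊗[ℂ] A} {ε : A →ₐ[ℂ] ℂ}
    (hτ : ∀ a, Algebra.TensorProduct.lmul' ℂ (τ a) = algebraMap ℂ A (ε a))
    {I : Ideal A} (hI : ∀ a ∈ I, ε a = 0) :
    FundLocalWeyl b A i I →ₗ[ℂ] FundGlobalWeyl b A i :=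
  -- Only an additive lift is possible at first: the map is balanced over `A`, but `A` acts through
  -- `ε` rather than by its right action on the target.
  let f : FundGlobalWeyl b A i ⊗[A] (A ⧸ I) →+ FundGlobalWeyl b A i :=
    TensorProduct.liftAddHom
      { toFun := fun w =>
          { toFun := fun q => Ideal.Quotient.liftₐ I ε hI q • twistedEnd b i τ w
            map_zero' := by simp
            map_add' := fun p q => by rw [map_add, add_smul] }
        map_zero' := by ext; simp
        map_add' := fun v w => by ext; simp }
      (fun a w q => by
        obtain ⟨c, rfl⟩ := Ideal.Quotient.mk_surjective q
        change ε c • twistedEnd b i τ (a • w) = ε (a * c) • twistedEnd b i τ w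
        rw [twistedEnd_smul_right b i hτ, smul_smul, map_mul, mul_comm])
  { f with
    map_smul' := fun z v => by
      change FundGlobalWeyl b A i ⊗[A] (A ⧸ I) at v
      change f (z • v) = z • f v
      induction v with
      | zero => simp
      | add v w hv hw => simp only [smul_add, map_add, hv, hw]
      | tmul w q =>
        change Ideal.Quotient.liftₐ I ε hI q • twistedEnd b i τ (z • w) =
          z • Ideal.Quotient.liftₐ I ε hI q • twistedEnd b i τ w
        rw [map_smul, smul_comm] }

section

variable {τ : A →ₐ[ℂ] A ⊗[ℂ] A} {ε : A →ₐ[ℂ] ℂ}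
  (hτ : ∀ a, Algebra.TensorProduct.lmul' ℂ (τ a) = algebraMap ℂ A (ε a))
  {I : Ideal A} (hI : ∀ a ∈ I, ε a = 0)

lemma twistedLift_gen :
    twistedLift b i hτ hI (FundLocalWeyl.gen b A i I) = FundGlobalWeyl.gen b A i := by
  change Ideal.Quotient.liftₐ I ε hI 1 • twistedEnd b i τ (FundGlobalWeyl.gen b A i) = _
  rw [map_one, one_smul, twistedEnd_gen]

lemma twistedLift_smul_gen (u : U A 𝔤) :
    twistedLift b i hτ hI (u • FundLocalWeyl.gen b A i I) =
      bimoduleAction _ (twistHom τ u) (FundGlobalWeyl.gen b A i) := by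
  change Ideal.Quotient.liftₐ I ε hI 1 • twistedEnd b i τ (u • FundGlobalWeyl.gen b A i) = _
  rw [map_one, one_smul, twistedEnd_smul, twistedEnd_gen]

lemma twistedLift_smul (u : U A 𝔤) (v : FundLocalWeyl b A i I) :
    twistedLift b i hτ hI (u • v) =
      bimoduleAction _ (twistHom τ u) (twistedLift b i hτ hI v) := by
  obtain ⟨x, rfl⟩ := FundLocalWeyl.exists_smul_gen b i I v
  rw [smul_smul, twistedLift_smul_gen, twistedLift_smul_gen, map_mul, map_mul,
    Module.End.mul_apply]

/-- The homomorphism `(W_A(ω_i) ⊗_A A/I ⊗ A)_Δ → W_A(ω_i)`. -/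
def ofTwist {Δ : A →ₐ[ℂ] A ⊗[ℂ] A}
    (h : (shear τ).comp Δ = Algebra.TensorProduct.includeLeft) :
    Twist (FundLocalWeyl b A i I) Δ →ₗ[U A 𝔤] FundGlobalWeyl b A i where
  toFun z := extendRight (twistedLift b i hτ hI) (Twist.untwist _ Δ z)
  map_add' y z := by rw [map_add, map_add]
  map_smul' u z := by
    -- The action through `Δ(u)` is carried to the shear of `Δ(u)` by `τ`, which is `u ⊗ 1`.
    rw [Twist.untwist_smul, extendRight_tensorAction_envShear _ τ (twistedLift_smul b i hτ hI),
      envShear_twistHom h, bimoduleAction_tmul, one_smul, RingHom.id_apply]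

variable {Δ : A →ₐ[ℂ] A ⊗[ℂ] A} (h : (shear τ).comp Δ = Algebra.TensorProduct.includeLeft)

lemma ofTwist_tmul (v : FundLocalWeyl b A i I) (c : A) :
    ofTwist b i hτ hI h (Twist.tmul v c) = c • twistedLift b i hτ hI v := rfl

lemma ofTwist_smul_right (a : A) (z : Twist (FundLocalWeyl b A i I) Δ) :
    ofTwist b i hτ hI h (a • z) = a • ofTwist b i hτ hI h z := by
  change extendRight _ (Twist.untwist _ Δ (a • z)) = a • extendRight _ (Twist.untwist _ Δ z)
  rw [Twist.untwist_smul_right 𝔤,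
    extendRight_tensorAction _ (twistHom τ) (twistedLift_smul b i hτ hI), map_one, one_mul,
    bimoduleAction_tmul, one_smul]

end

/-- The global Weyl module is obtained from the local Weyl module at the counit by twisting. -/
theorem existsUnique_equiv_twist {Δ τ : A →ₐ[ℂ] A ⊗[ℂ] A} {ε : A →ₐ[ℂ] ℂ}
    (hτ : ∀ a, Algebra.TensorProduct.lmul' ℂ (τ a) = algebraMap ℂ A (ε a))
    {I : Ideal A} (hI : ∀ a ∈ I, ε a = 0)
    (h : (shear τ).comp Δ = Algebra.TensorProduct.includeLeft)
    (h' : (shear Δ).comp τ = Algebra.TensorProduct.includeLeft)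
    (hI' : ∀ a, ε a = 0 → a ∈ I)
    (hε : ∀ a, Algebra.TensorProduct.lid ℂ A
      (Algebra.TensorProduct.map ε (AlgHom.id ℂ A) (Δ a)) = a) :
    ∃! Φ : FundGlobalWeyl b A i ≃ₗ[U A 𝔤] Twist (FundLocalWeyl b A i I) Δ,
      Φ (FundGlobalWeyl.gen b A i) = Twist.tmul (FundLocalWeyl.gen b A i I) 1 ∧
        ∀ (a : A) (w : FundGlobalWeyl b A i), Φ (a • w) = a • Φ w := by
  have hgen : ofTwist b i hτ hI h (Twist.tmul (FundLocalWeyl.gen b A i I) 1) =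
      FundGlobalWeyl.gen b A i := by
    rw [ofTwist_tmul, twistedLift_gen, one_smul]
  have hleft : ofTwist b i hτ hI h ∘ₗ toTwist b i Δ I = LinearMap.id :=
    FundGlobalWeyl.hom_ext b i (by
      rw [LinearMap.comp_apply, toTwist_gen, hgen, LinearMap.id_apply])
  -- Generation of the twist by `v ⊗ 1` uses both actions, so right linearity of both maps is needed
  -- here.
  have hright : (toTwist b i Δ I ∘ₗ ofTwist b i hτ hI h).toAddMonoidHom = AddMonoidHom.id _ :=
    Twist.hom_ext_of_cyclic h' (FundLocalWeyl.exists_smul_gen b i I)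
      (fun u z => map_smul (toTwist b i Δ I ∘ₗ ofTwist b i hτ hI h) u z)
      (fun a z => by
        change toTwist b i Δ I (ofTwist b i hτ hI h (a • z)) =
          a • toTwist b i Δ I (ofTwist b i hτ hI h z)
        rw [ofTwist_smul_right, toTwist_smul_right b i hI' hε])
      (fun _ _ => rfl) (fun _ _ => rfl)
      (by
        change toTwist b i Δ I (ofTwist b i hτ hI h _) = _
        rw [hgen, toTwist_gen]
        rfl)
  refine ⟨LinearEquiv.ofLinearMap (toTwist b i Δ I) (ofTwist b i hτ hI h)
    (LinearMap.ext fun z => DFunLike.congr_fun hright z) hleft,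
    ⟨toTwist_gen b i Δ I, toTwist_smul_right b i hI' hε⟩, fun Φ hΦ => ?_⟩
  apply LinearEquiv.toLinearMap_injective
  -- The image of the cyclic generator already determines `Φ`.
  exact FundGlobalWeyl.hom_ext b i (hΦ.1.trans (toTwist_gen b i Δ I).symm)

end Comparison

/-! ### The Hopf algebra structure of `ℂ[t_1^±, …, t_k^±, u_1, …, u_ℓ]` -/

namespace RAlg

variable (k ℓ : ℕ)

/-- The homomorphism `a ↦ ∑ a' ⊗ S(a'')`, where `S` is the antipode: `t_s ↦ t_s ⊗ t_s⁻¹` and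
`u_r ↦ u_r ⊗ 1 - 1 ⊗ u_r`. -/
def comulInv : RAlg k ℓ →ₐ[ℂ] RAlg k ℓ ⊗[ℂ] RAlg k ℓ :=
  MvPolynomial.aevalTower
    (AddMonoidAlgebra.lift ℂ (RAlg k ℓ ⊗[ℂ] RAlg k ℓ) (Fin k → ℤ)
      { toFun := fun m => tPow ℓ m.toAdd ⊗ₜ[ℂ] tPow ℓ (-m.toAdd)
        map_one' := by
          rw [toAdd_one, neg_zero, tPow_zero, Algebra.TensorProduct.one_def]
        map_mul' := fun m n => by
          rw [toAdd_mul, neg_add, tPow_add, tPow_add, Algebra.TensorProduct.tmul_mul_tmul] })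
    (fun r => u k r ⊗ₜ[ℂ] 1 - 1 ⊗ₜ[ℂ] u k r)

lemma comulInv_tPow (m : Fin k → ℤ) :
    comulInv k ℓ (tPow ℓ m) = tPow ℓ m ⊗ₜ[ℂ] tPow ℓ (-m) := by
  simp [comulInv, tPow]

lemma comulInv_u (r : Fin ℓ) :
    comulInv k ℓ (u k r) = u k r ⊗ₜ[ℂ] 1 - 1 ⊗ₜ[ℂ] u k r := by
  simp [comulInv, u]

/-- On generators: `(t^m ⊗ t^{-m})(1 ⊗ t^m) = t^m ⊗ 1` and `(u_r ⊗ 1 - 1 ⊗ u_r) + 1 ⊗ u_r = u_r ⊗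
1`. -/
lemma shear_comulInv_comp_comul :
    (shear (comulInv k ℓ)).comp (comul k ℓ) = Algebra.TensorProduct.includeLeft := by
  apply hom_ext
  · intro m
    simp [comul_tPow, shear, comulInv_tPow, ← tPow_add, tPow_zero]
  · intro r
    simp [comul_u, shear, comulInv_u, ← Algebra.TensorProduct.one_def]

lemma shear_comul_comp_comulInv :
    (shear (comul k ℓ)).comp (comulInv k ℓ) = Algebra.TensorProduct.includeLeft := by
  apply hom_ext
  · intro m
    simp [comul_tPow, shear, comulInv_tPow, ← tPow_add, tPow_zero]
  · intro r
    simp [comul_u, shear, comulInv_u, ← Algebra.TensorProduct.one_def]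

/-- The antipode axiom `∑ a' S(a'') = ε(a)`. -/
lemma lmul'_comulInv (a : RAlg k ℓ) :
    Algebra.TensorProduct.lmul' ℂ (comulInv k ℓ a) =
      algebraMap ℂ (RAlg k ℓ) (counit k ℓ a) := by
  suffices (Algebra.TensorProduct.lmul' ℂ).comp (comulInv k ℓ) =
      (Algebra.ofId ℂ (RAlg k ℓ)).comp (counit k ℓ) from DFunLike.congr_fun this a
  apply hom_ext
  · intro m
    rw [AlgHom.comp_apply, AlgHom.comp_apply, comulInv_tPow, counit_tPow, map_one,
      Algebra.TensorProduct.lmul'_apply_tmul, ← tPow_add, add_neg_cancel, tPow_zero]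
  · intro r
    simp [comulInv_u, counit_u]

lemma lid_map_counit_comul (a : RAlg k ℓ) :
    Algebra.TensorProduct.lid ℂ (RAlg k ℓ) (Algebra.TensorProduct.map (counit k ℓ)
      (AlgHom.id ℂ (RAlg k ℓ)) (comul k ℓ a)) = a := by
  suffices ((Algebra.TensorProduct.lid ℂ (RAlg k ℓ)).toAlgHom.comp
      (Algebra.TensorProduct.map (counit k ℓ) (AlgHom.id ℂ (RAlg k ℓ)))).comp (comul k ℓ) =
        AlgHom.id ℂ _ from DFunLike.congr_fun this a
  apply hom_ext
  · intro m
    simp [comul_tPow, counit_tPow]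
  · intro r
    simp [comul_u, counit_u]

lemma counit_eq_zero_of_mem {a : RAlg k ℓ} (ha : a ∈ pointIdeal k ℓ) : counit k ℓ a = 0 := by
  have h : pointIdeal k ℓ ≤ RingHom.ker (counit k ℓ) := by
    rw [pointIdeal, Ideal.span_le]
    rintro _ (⟨s, rfl⟩ | ⟨r, rfl⟩)
    · simp [RingHom.mem_ker, t, counit_tPow]
    · simp [RingHom.mem_ker, counit_u]
  exact h ha

/-- The ideal contains only `t_s - 1`, yet negative exponents follow: `m ↦ t^m` is a homomorphism
from the group `ℤ^k`, trivial modulo the ideal on the standard generators. -/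
lemma mk_tPow (m : Fin k → ℤ) : Ideal.Quotient.mk (pointIdeal k ℓ) (tPow ℓ m) = 1 := by
  let f : Multiplicative (Fin k → ℤ) →* RAlg k ℓ ⧸ pointIdeal k ℓ :=
    { toFun := fun m => Ideal.Quotient.mk _ (tPow ℓ m.toAdd)
      map_one' := by rw [toAdd_one, tPow_zero, map_one]
      map_mul' := fun m n => by rw [toAdd_mul, tPow_add, map_mul] }
  have ht (s : Fin k) : f (.ofAdd (Pi.single s 1)) = 1 := by
    rw [← sub_eq_zero]
    change Ideal.Quotient.mk _ (t ℓ s) - Ideal.Quotient.mk _ 1 = 0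
    rw [← map_sub, Ideal.Quotient.eq_zero_iff_mem]
    exact Ideal.subset_span (Or.inl ⟨s, rfl⟩)
  have hm : Multiplicative.ofAdd m = ∏ s, Multiplicative.ofAdd (Pi.single s 1) ^ m s := by
    apply Multiplicative.toAdd.injective
    rw [toAdd_prod]
    ext s
    simp [Finset.sum_apply, Pi.single_apply]
  have key (s : Fin k) (n : ℤ) : f (.ofAdd (Pi.single s 1) ^ n) = 1 := by
    -- Integer powers require a group as target, hence the passage to units of the quotient.
    have := congrArg Units.val (map_zpow f.toHomUnits (.ofAdd (Pi.single s 1)) n)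
    rw [show f.toHomUnits (.ofAdd (Pi.single s 1)) = 1 from Units.ext (ht s), one_zpow] at this
    exact this
  change f (.ofAdd m) = 1
  rw [hm, map_prod]
  exact Finset.prod_eq_one fun s _ => key s _

lemma mem_pointIdeal_of_counit_eq_zero {a : RAlg k ℓ} (ha : counit k ℓ a = 0) :
    a ∈ pointIdeal k ℓ := by
  -- The quotient map factors through `ε`, since both sides agree on the `t^m` and the `u_r`; so the
  -- ideal is all of `ker ε`.
  have h : Ideal.Quotient.mkₐ ℂ (pointIdeal k ℓ) =
      (Algebra.ofId ℂ (RAlg k ℓ ⧸ pointIdeal k ℓ)).comp (counit k ℓ) := by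
    refine hom_ext (B := RAlg k ℓ ⧸ pointIdeal k ℓ) ?_ ?_
    · intro m
      rw [AlgHom.comp_apply, counit_tPow, map_one, Ideal.Quotient.mkₐ_eq_mk, mk_tPow]
    · intro r
      rw [AlgHom.comp_apply, counit_u, map_zero, Ideal.Quotient.mkₐ_eq_mk,
        Ideal.Quotient.eq_zero_iff_mem]
      exact Ideal.subset_span (Or.inr ⟨r, rfl⟩)
  rw [← Ideal.Quotient.eq_zero_iff_mem, ← Ideal.Quotient.mkₐ_eq_mk ℂ, h, AlgHom.comp_apply, ha,
    map_zero]

end RAlg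

end WeylModules

end

theorem mainTheorem4 {𝔤 : Type*} [LieRing 𝔤] [LieAlgebra ℂ 𝔤] [FiniteDimensional ℂ 𝔤]
    [LieAlgebra.IsSimple ℂ 𝔤] (H : LieSubalgebra ℂ 𝔤) [H.IsCartanSubalgebra]
    (b : (LieAlgebra.IsKilling.rootSystem H).Base) (i : b.support) (k ℓ : ℕ) :
    ∃! Φ : WeylModules.FundGlobalWeyl b (WeylModules.RAlg k ℓ) i
        ≃ₗ[WeylModules.U (WeylModules.RAlg k ℓ) 𝔤]
          WeylModules.Twist
            (WeylModules.FundLocalWeyl b (WeylModules.RAlg k ℓ) i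
              (WeylModules.RAlg.pointIdeal k ℓ))
            (WeylModules.RAlg.comul k ℓ),
      Φ (WeylModules.FundGlobalWeyl.gen b (WeylModules.RAlg k ℓ) i) =
          WeylModules.Twist.tmul
            (WeylModules.FundLocalWeyl.gen b (WeylModules.RAlg k ℓ) i
              (WeylModules.RAlg.pointIdeal k ℓ)) 1 ∧
        ∀ (a : WeylModules.RAlg k ℓ)
          (w : WeylModules.FundGlobalWeyl b (WeylModules.RAlg k ℓ) i), Φ (a • w) = a • Φ w := by
  exact WeylModules.existsUnique_equiv_twist b i (WeylModules.RAlg.lmul'_comulInv k ℓ)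
    (fun _ => WeylModules.RAlg.counit_eq_zero_of_mem k ℓ)
    (WeylModules.RAlg.shear_comulInv_comp_comul k ℓ)
    (WeylModules.RAlg.shear_comul_comp_comulInv k ℓ)
    (fun _ => WeylModules.RAlg.mem_pointIdeal_of_counit_eq_zero k ℓ)
    (WeylModules.RAlg.lid_map_counit_comul k ℓ)
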